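/- For a $0/1$ matrix $\mathbf B$ of size $m\times n$, the Boolean rank of $\mathbf B$ is the least $s\ge 0$ such that $\mathbf B=\mathbf U\wedge\mathbf V$ for a $0/1$ matrix $\mathbf U$ of size $m\times s$ and a $0/1$ matrix $\mathbf V$ of size $s\times n$, where the matrix product is taken over the Boolean semiring $(\{0,1\},\vee,\wedge)$. In the problem \textsc{Low Boolean-Rank Approximation} one is given a $0/1$ matrix $\mathbf A$ of size $m\times n$ (with $m,n\ge 1$), a positive integer $r$ and a nonnegative integer $k$, and has to decide whether there is a $0/1$ matrix $\mathbf B$ of size $m\times n$ and of Boolean rank at most $r$ that differs from $\mathbf A$ in at most $k$ entries. Theorem. There is a deterministic algorithm (a single program for a random access machine that performs additions, subtractions, tests and direct or indirect memory accesses on natural numbers in one time unit each) that solves every instance $(\mathbf A,r,k)$ of \textsc{Low Boolean-Rank Approximation} in time $2^{\mathcal O(r2^r\sqrt{k\log k})}\cdot(nm)^{\mathcal O(1)}$, where for $k\le 1$ the factor $\sqrt{k\log k}$ is read as $1$. That is, there are absolute constants $c,d$ such that the running time on $(\mathbf A,r,k)$ is at most $2^{c\,r2^r\max\{1,\sqrt{k\log_2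 k}\}}\cdot(nm)^{d}$. -/

import Mathlib

/-! ### Boolean matrices, Boolean rank, Hamming distance -/

namespace BoolRank

/-- The matrix product over the Boolean semiring `({0,1}, ∨, ∧)`. -/
def boolMul {m n r : ℕ} (U : Matrix (Fin m) (Fin r) Bool) (V : Matrix (Fin r) (Fin n) Bool) :
    Matrix (Fin m) (Fin n) Bool :=
  fun i j => decide (∃ l, U i l = true ∧ V l j = true)

/-- The Boolean rank: the least `r` such that `A` is the Boolean product of an `m × r` matrix and
an `r × n` matrix. -/
noncomputable def booleanRank {m n : ℕ} (A : Matrix (Fin m) (Fin n) Bool) : ℕ :=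
  sInf {r | ∃ (U : Matrix (Fin m) (Fin r) Bool) (V : Matrix (Fin r) (Fin n) Bool),
    A = boolMul U V}

/-- The set in the definition of the Boolean rank is never empty. -/
theorem exists_boolMul {m n : ℕ} (A : Matrix (Fin m) (Fin n) Bool) :
    {r | ∃ (U : Matrix (Fin m) (Fin r) Bool) (V : Matrix (Fin r) (Fin n) Bool),
      A = boolMul U V}.Nonempty := by
  refine ⟨n, A, fun l j => decide (l = j), ?_⟩
  funext i j
  simp [boolMul]

/-- `d_H(A, B)`: the sum of the Hamming distances of corresponding columns. -/
def matrixHammingDist {m n : ℕ} (A B : Matrix (Fin m) (Fin n) Bool) : ℕ :=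
  ∑ j, hammingDist (fun i => A i j) (fun i => B i j)

end BoolRank

/-! ### Random access machines

A program has finitely many registers (addressed directly) and an unbounded memory (addressed
indirectly); every register and memory cell holds a natural number. Every elementary operation
(reading a constant, a register or a memory cell, addition, truncated subtraction, assignment,
store, test) takes one time unit. There is no multiplication, so that the length of the numbers
grows by at most one bit per time unit, and the model is polynomially equivalent to Turing
machines. -/

namespace RAM

/-- The contents of the registers and of the memory. -/
structure State where
  reg : ℕ → ℕ
  mem : ℕ → ℕ

/-- Expressions: constants, registers, indirect memory access, addition, truncated subtraction. -/
inductive Expr where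
  | const (c : ℕ)
  | reg (i : ℕ)
  | read (address : Expr)
  | plus (a b : Expr)
  | minus (a b : Expr)

/-- The value of an expression. -/
def Expr.eval (s : State) : Expr → ℕ
  | .const c => c
  | .reg i => s.reg i
  | .read a => s.mem (a.eval s)
  | .plus a b => a.eval s + b.eval s
  | .minus a b => a.eval s - b.eval s

/-- The time needed to evaluate an expression: one unit for each operation in it. -/
def Expr.cost : Expr → ℕ
  | .const _ => 1
  | .reg _ => 1
  | .read a => a.cost + 1
  | .plus a b => a.cost + b.cost + 1
  | .minus a b => a.cost + b.cost + 1

/-- Programs, with structured control flow. A test `e` succeeds when the value of `e` is not `0`. -/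
inductive Program where
  | skip
  | assign (i : ℕ) (e : Expr)
  | store (address value : Expr)
  | seq (p q : Program)
  | ite (test : Expr) (p q : Program)
  | loop (test : Expr) (body : Program)

/-- `Exec p s s' t`: the program `p`, started in the state `s`, halts in the state `s'` after
exactly `t` time units. -/
inductive Exec : Program → State → State → ℕ → Prop where
  | skip (s : State) : Exec .skip s s 1
  | assign (s : State) (i : ℕ) (e : Expr) :
      Exec (.assign i e) s { s with reg := Function.update s.reg i (e.eval s) } (e.cost + 1)
  | store (s : State) (a e : Expr) :
      Exec (.store a e) s { s with mem := Function.update s.mem (a.eval s) (e.eval s) }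
        (a.cost + e.cost + 1)
  | seq {p q : Program} {s s₁ s₂ : State} {t₁ t₂ : ℕ}
      (hp : Exec p s s₁ t₁) (hq : Exec q s₁ s₂ t₂) : Exec (.seq p q) s s₂ (t₁ + t₂)
  | ite_pos {e : Expr} {p q : Program} {s s₁ : State} {t : ℕ}
      (he : e.eval s ≠ 0) (hp : Exec p s s₁ t) : Exec (.ite e p q) s s₁ (e.cost + 1 + t)
  | ite_neg {e : Expr} {p q : Program} {s s₁ : State} {t : ℕ}
      (he : e.eval s = 0) (hq : Exec q s s₁ t) : Exec (.ite e p q) s s₁ (e.cost + 1 + t)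
  | loop_stop {e : Expr} {p : Program} {s : State}
      (he : e.eval s = 0) : Exec (.loop e p) s s (e.cost + 1)
  | loop_step {e : Expr} {p : Program} {s s₁ s₂ : State} {t₁ t₂ : ℕ}
      (he : e.eval s ≠ 0) (hp : Exec p s s₁ t₁) (hl : Exec (.loop e p) s₁ s₂ t₂) :
      Exec (.loop e p) s s₂ (e.cost + 1 + t₁ + t₂)

/-- The machine is deterministic: the final state and the running time are determined by the
program and the initial state. -/
theorem Exec.deterministic {p : Program} {s s₁ s₂ : State} {t₁ t₂ : ℕ}
    (h₁ : Exec p s s₁ t₁) (h₂ : Exec p s s₂ t₂) : s₁ = s₂ ∧ t₁ = t₂ := by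
  induction h₁ generalizing s₂ t₂ with
  | skip s => cases h₂; exact ⟨rfl, rfl⟩
  | assign s i e => cases h₂; exact ⟨rfl, rfl⟩
  | store s a e => cases h₂; exact ⟨rfl, rfl⟩
  | seq _ _ ih₁ ih₂ =>
    cases h₂ with
    | seq a b =>
      obtain ⟨rfl, rfl⟩ := ih₁ a
      obtain ⟨rfl, rfl⟩ := ih₂ b
      exact ⟨rfl, rfl⟩
  | ite_pos he _ ih =>
    cases h₂ with
    | ite_pos _ a => obtain ⟨rfl, rfl⟩ := ih a; exact ⟨rfl, rfl⟩
    | ite_neg he' _ => exact absurd he' he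
  | ite_neg he _ ih =>
    cases h₂ with
    | ite_pos he' _ => exact absurd he he'
    | ite_neg _ a => obtain ⟨rfl, rfl⟩ := ih a; exact ⟨rfl, rfl⟩
  | loop_stop he =>
    cases h₂ with
    | loop_stop _ => exact ⟨rfl, rfl⟩
    | loop_step he' _ _ => exact absurd he he'
  | loop_step he _ _ ih₁ ih₂ =>
    cases h₂ with
    | loop_stop he' => exact absurd he' he
    | loop_step _ a b =>
      obtain ⟨rfl, rfl⟩ := ih₁ a
      obtain ⟨rfl, rfl⟩ := ih₂ b
      exact ⟨rfl, rfl⟩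

/-- The program `p` solves the decision problem with instances `I`, input convention `input` and
yes-instances `yes` in time `T`: on every instance `x` it halts within `T x` time units, with
output (the final content of register `0`) equal to `1` if `x` is a yes-instance, and to `0`
otherwise. -/
def DecidesInTime {I : Type} (p : Program) (input : I → State) (yes : I → Prop) (T : I → ℝ) :
    Prop :=
  ∀ x : I, ∃ (s : State) (t : ℕ), Exec p (input x) s t ∧ (t : ℝ) ≤ T x ∧
    (yes x → s.reg 0 = 1) ∧ (¬ yes x → s.reg 0 = 0)

end RAM

/-! ### The problem Low Boolean-Rank Approximation -/

namespace BoolRank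

/-- An instance: a Boolean `m × n` matrix `A`, a positive integer `r`, a nonnegative integer `k`. -/
structure Instance where
  m : ℕ
  n : ℕ
  m_pos : 0 < m
  n_pos : 0 < n
  A : Matrix (Fin m) (Fin n) Bool
  r : ℕ
  r_pos : 0 < r
  k : ℕ

/-- Yes-instances: some Boolean matrix of Boolean rank at most `r` differs from `A` in at most `k`
entries. -/
def Instance.IsYes (x : Instance) : Prop :=
  ∃ B : Matrix (Fin x.m) (Fin x.n) Bool, booleanRank B ≤ x.r ∧ matrixHammingDist x.A B ≤ x.k

/-- The initial state: `m`, `n`, `r`, `k` are in the registers `0`, `1`, `2`, `3`, and the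
entries of `A` are, row by row, in the memory cells `0, …, m * n - 1`; all else is `0`. -/
def Instance.input (x : Instance) : RAM.State where
  reg i := match i with
    | 0 => x.m
    | 1 => x.n
    | 2 => x.r
    | 3 => x.k
    | _ => 0
  mem a := if h : a / x.n < x.m ∧ a % x.n < x.n then (x.A ⟨a / x.n, h.1⟩ ⟨a % x.n, h.2⟩).toNat else 0

end BoolRank

/-!
The algorithm clusters the columns of the matrix. In a solution with row types `u i` and column
types `v j`, which are subsets of `{0, …, r - 1}`, the entry `(i, j)` is `1` if and only if `u i`
and `v j` meet, so that all columns of one type `T` share one column, the center of `T`. Conversely,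
once the types of all columns are known, the best type of each row is found by trying all `2 ^ r` of
them. Hence any choice of column types gives an approximation whose cost can be computed, and
accepting an instance is always justified if this cost is at most `k`. It remains to list few enough
choices, one of which is good whenever there is a solution.

Let `s` be about `√(k / log k)`. A type is guessable if some column of this type is at distance at
most `s` from its center; this center is then known from that column and at most `s` changes in it.
Guess the centers of all guessable types. A column at distance at most `s` from one of them is
given the type of the nearest one: if its true type is not guessable, then its true center is
farther away (`Guess.Faithful.trueDist_best_le`). Every other column costs more than `s` changes
in the solution, so there are at most `k / s`, that is, about `√(k log k)` of them
(`Guess.Faithful.count_far_le`), and their types are guessed, at `r` bits each.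

For the guesses of the centers to be few, they have to be expressed in terms of classes of equal
lines: a yes-instance has at most `2 ^ r + k` different rows, and as many different columns
(`count_isLeader_le`), and the row types may be assumed to depend on the contents of the row only
(`exists_row_types`), so that whole classes of rows are changed. A center thus costs `s + 1` digits
in base `2 ^ r + k + 1`, which gives `2 ^ O(r * 2 ^ r * √(k log k))` guesses in all (`cutoff_le`).

The algorithm only needs to enumerate the guesses and to evaluate, for each of them, an expression
that reads the matrix. It is therefore written in a functional language without side effects, whose
only loop is bounded iteration, and compiled to the machine (`Term.compile_yields`). All iterations
are cut off after `B` rounds, for a number `B` in a fixed register. So the running time of a term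
is at most a polynomial in `B` that depends on the term alone (`Term.cost_le`), and what has to be
proved about the loops is that the cut-off does not affect the value. The number `B` is chosen at
least as large as the number of guesses, and polynomial in it and in `n * m`. In this setting
numbers can be handled in unary: multiplication, division and the extraction of digits are done by
iteration.
-/

/-! ### A functional language for the random access machine -/

namespace RAM

/-- Terms of a small functional language over the natural numbers. `var i` is the `i`-th entry of
the environment, `read a` a memory cell, `ite c a b` a test of `c ≠ 0`, `fold N x f` the bounded
iteration that starts with `x` and, for `i < N`, replaces the current value `y` by `f`, evaluated
in the environment extended by `i` and `y`; `call args f` evaluates `f` in the environment that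
consists of the values of `args` only. Terms never write to the memory. -/
inductive Term where
  | const (c : ℕ)
  | var (i : ℕ)
  | read (a : Term)
  | add (a b : Term)
  | sub (a b : Term)
  | ite (c a b : Term)
  | fold (N x f : Term)
  | call {n : ℕ} (args : Fin n → Term) (f : Term)

/-- `iterFrom f x n` is `f (n - 1) (⋯ (f 1 (f 0 x)))`. -/
def iterFrom (f : ℕ → ℕ → ℕ) (x : ℕ) : ℕ → ℕ
  | 0 => x
  | n + 1 => f n (iterFrom f x n)

/-- The value of a term, for the memory `M` and an environment. Every iteration is cut off after
`B` rounds; this makes the running time a polynomial in `B` that depends on the term alone. -/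
def Term.eval (B : ℕ) (M : ℕ → ℕ) : Term → List ℕ → ℕ
  | .const c, _ => c
  | .var i, e => e.getD i 0
  | .read a, e => M (a.eval B M e)
  | .add a b, e => a.eval B M e + b.eval B M e
  | .sub a b, e => a.eval B M e - b.eval B M e
  | .ite c a b, e => if c.eval B M e ≠ 0 then a.eval B M e else b.eval B M e
  | .fold N x f, e =>
    iterFrom (fun i y => f.eval B M (e ++ [i, y])) (x.eval B M e) (min (N.eval B M e) B)
  | .call args f, e => f.eval B M (List.ofFn fun i => (args i).eval B M e)

/-- The programs `p 0, …, p (n - 1)`, one after the other. -/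
def seqUpTo (p : ℕ → Program) : ℕ → Program
  | 0 => .skip
  | n + 1 => .seq (seqUpTo p n) (p n)

/-- The program for a term. The environment is held in the registers listed in `ρ`, the registers
from `L` on are free, and the value is left in register `L`. Register `4` holds the cut-off for
iterations. -/
def Term.compile : Term → List ℕ → ℕ → Program
  | .const c, _, L => .assign L (.const c)
  | .var i, ρ, L => .assign L (if i < ρ.length then .reg (ρ.getD i 0) else .const 0)
  | .read a, ρ, L => .seq (a.compile ρ L) (.assign L (.read (.reg L)))
  | .add a b, ρ, L =>
    .seq (a.compile ρ L) (.seq (b.compile ρ (L + 1)) (.assign L (.plus (.reg L) (.reg (L + 1)))))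
  | .sub a b, ρ, L =>
    .seq (a.compile ρ L) (.seq (b.compile ρ (L + 1)) (.assign L (.minus (.reg L) (.reg (L + 1)))))
  | .ite c a b, ρ, L => .seq (c.compile ρ L) (.ite (.reg L) (a.compile ρ L) (b.compile ρ L))
  | .fold N x f, ρ, L =>
    .seq (N.compile ρ L) <|
    .seq (.assign L (.minus (.reg L) (.minus (.reg L) (.reg 4)))) <|
    .seq (x.compile ρ (L + 1)) <|
    .seq (.assign (L + 2) (.const 0)) <|
    .seq (.loop (.minus (.reg L) (.reg (L + 2)))
      (.seq (f.compile (ρ ++ [L + 2, L + 1]) (L + 3))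
        (.seq (.assign (L + 1) (.reg (L + 3)))
          (.assign (L + 2) (.plus (.reg (L + 2)) (.const 1))))))
      (.assign L (.reg (L + 1)))
  | .call (n := n) args f, ρ, L =>
    .seq (seqUpTo (fun j => if h : j < n then (args ⟨j, h⟩).compile ρ (L + j) else .skip) n) <|
    .seq (f.compile (List.ofFn fun i : Fin n => L + i) (L + n)) (.assign L (.reg (L + n)))

/-- A bound for the running time of the program for a term, if iterations are cut off after `B`
rounds. -/
def Term.cost (B : ℕ) : Term → ℕ
  | .const _ => 2
  | .var _ => 2
  | .read a => a.cost B + 3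
  | .add a b => a.cost B + b.cost B + 4
  | .sub a b => a.cost B + b.cost B + 4
  | .ite c a b => c.cost B + a.cost B + b.cost B + 2
  | .fold N x f => N.cost B + x.cost B + 14 + B * (f.cost B + 10)
  | .call args f => (∑ i, (args i).cost B) + f.cost B + 3

/-- `Yields p s L T v`: started in `s`, the program `p` halts within time `T`, leaves the value `v`
in register `L`, and changes neither the memory nor a register below `L`. -/
def Yields (p : Program) (s : State) (L T v : ℕ) : Prop :=
  ∃ s' t, Exec p s s' t ∧ t ≤ T ∧ s'.mem = s.mem ∧ (∀ i < L, s'.reg i = s.reg i) ∧ s'.reg L = v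

/-- The loop in the program for `fold`, started after `i` rounds. -/
theorem exec_loop {f : Term} {ρ : List ℕ} {L C : ℕ} {g : ℕ → ℕ → ℕ} {x N : ℕ}
    {M reg : ℕ → ℕ}
    (hf : ∀ s : State, s.mem = M → (∀ j < L, s.reg j = reg j) →
      Yields (f.compile (ρ ++ [L + 2, L + 1]) (L + 3)) s (L + 3) C
        (g (s.reg (L + 2)) (s.reg (L + 1)))) (d : ℕ) :
    ∀ (s : State) (i : ℕ), s.mem = M → (∀ j < L, s.reg j = reg j) → i + d = N → s.reg L = N →
      s.reg (L + 2) = i → s.reg (L + 1) = iterFrom g x i →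
      ∃ s' t, Exec (.loop (.minus (.reg L) (.reg (L + 2)))
        (.seq (f.compile (ρ ++ [L + 2, L + 1]) (L + 3))
          (.seq (.assign (L + 1) (.reg (L + 3)))
            (.assign (L + 2) (.plus (.reg (L + 2)) (.const 1)))))) s s' t ∧
        t ≤ d * (C + 10) + 4 ∧ s'.mem = M ∧ (∀ j < L, s'.reg j = reg j) ∧
        s'.reg (L + 1) = iterFrom g x N := by
  induction d with
  | zero =>
    intro s i hM hr hd hN hi hy
    refine ⟨s, _, Exec.loop_stop ?_, ?_, hM, hr, ?_⟩
    · simp only [Expr.eval]; omega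
    · simp [Expr.cost]
    · rw [hy, show i = N by omega]
  | succ d ih =>
    intro s i hM hr hd hN hi hy
    obtain ⟨s₁, t₁, e₁, ht₁, hm₁, hr₁, hv₁⟩ := hf s hM hr
    have e₂ := Exec.assign s₁ (L + 1) (.reg (L + 3))
    set s₂ : State :=
      { s₁ with reg := Function.update s₁.reg (L + 1) ((Expr.reg (L + 3)).eval s₁) } with hs₂
    have e₃ := Exec.assign s₂ (L + 2) (.plus (.reg (L + 2)) (.const 1))
    set s₃ : State :=
      { s₂ with
        reg := Function.update s₂.reg (L + 2)
          ((Expr.plus (.reg (L + 2)) (.const 1)).eval s₂) } with hs₃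
    have hr₃ : ∀ j ≤ L, s₃.reg j = s.reg j := fun j hj => by
      simp only [hs₃, hs₂, Function.update_of_ne (show j ≠ L + 2 by omega),
        Function.update_of_ne (show j ≠ L + 1 by omega)]
      exact hr₁ j (by omega)
    obtain ⟨s', t', e', ht', hm', hr', hv'⟩ := ih s₃ (i + 1) (hm₁.trans hM)
      (fun j hj => (hr₃ j hj.le).trans (hr j hj)) (by omega) ((hr₃ L le_rfl).trans hN)
      (by
        simp only [hs₃, hs₂, Function.update_self, Expr.eval,
          Function.update_of_ne (show L + 2 ≠ L + 1 by omega)]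
        rw [hr₁ (L + 2) (by omega), hi])
      (by
        simp only [hs₃, hs₂, Function.update_self, Expr.eval,
          Function.update_of_ne (show L + 1 ≠ L + 2 by omega)]
        rw [hv₁, hi, hy, iterFrom])
    refine ⟨s', _, Exec.loop_step ?_ (Exec.seq e₁ (Exec.seq e₂ e₃)) e', ?_, hm', hr', hv'⟩
    · simp only [Expr.eval]; omega
    · simp only [Expr.cost]
      nlinarith

/-- The programs for the arguments of a call. -/
theorem exec_args {n : ℕ} {args : Fin n → Term} {ρ : List ℕ} {L B : ℕ} {M reg : ℕ → ℕ}
    (h : ∀ (i : Fin n) (s : State), s.mem = M → (∀ j < L, s.reg j = reg j) →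
      Yields ((args i).compile ρ (L + i)) s (L + i) ((args i).cost B)
        ((args i).eval B M (ρ.map reg))) (k : ℕ) (hk : k ≤ n) (s : State) (hM : s.mem = M)
    (hr : ∀ j < L, s.reg j = reg j) :
    ∃ s' t, Exec (seqUpTo
        (fun j => if h : j < n then (args ⟨j, h⟩).compile ρ (L + j) else .skip) k) s s' t ∧
      t ≤ (∑ i ∈ Finset.range k, if h : i < n then (args ⟨i, h⟩).cost B else 0) + 1 ∧
      s'.mem = M ∧ (∀ j < L, s'.reg j = reg j) ∧
      ∀ i : Fin n, (i : ℕ) < k → s'.reg (L + i) = (args i).eval B M (ρ.map reg) := by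
  induction k with
  | zero => exact ⟨s, 1, Exec.skip s, by simp, hM, hr, by simp⟩
  | succ k ih =>
    obtain ⟨s₁, t₁, e₁, ht₁, hm₁, hr₁, hv₁⟩ := ih (by omega)
    obtain ⟨s₂, t₂, e₂, ht₂, hm₂, hr₂, hv₂⟩ := h ⟨k, by omega⟩ s₁ hm₁ hr₁
    refine ⟨s₂, t₁ + t₂, Exec.seq e₁ ?_, ?_, hm₂.trans hm₁, ?_, ?_⟩
    · simpa [show k < n by omega] using e₂
    · rw [Finset.sum_range_succ, dif_pos (show k < n by omega)]; omega
    · intro j hj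
      rw [hr₂ j (by simp; omega), hr₁ j hj]
    · intro i hi
      rcases Nat.lt_succ_iff_lt_or_eq.1 hi with hi | hi
      · rw [hr₂ _ (by simp; omega), hv₁ i hi]
      · subst hi
        exact hv₂

/-- The program for a term computes its value, within the time given by `Term.cost`. -/
theorem Term.compile_yields (t : Term) : ∀ (ρ : List ℕ) (L : ℕ) (s : State), 4 < L →
    (∀ x ∈ ρ, x < L) →
    Yields (t.compile ρ L) s L (t.cost (s.reg 4)) (t.eval (s.reg 4) s.mem (ρ.map s.reg)) := by
  have key : ∀ (ρ : List ℕ) (L : ℕ) (s s' : State), (∀ x ∈ ρ, x < L) →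
      (∀ i < L, s'.reg i = s.reg i) → ρ.map s'.reg = ρ.map s.reg := fun ρ L s s' hρ h =>
    List.map_congr_left fun x hx => h x (hρ x hx)
  induction t with
  | const c =>
    intro ρ L s hL hρ
    exact ⟨_, _, Exec.assign s L _, by simp [Expr.cost, cost], rfl,
      fun i hi => by simp [Function.update_of_ne hi.ne], by simp [Expr.eval, eval]⟩
  | var i =>
    intro ρ L s hL hρ
    refine ⟨_, _, Exec.assign s L _, ?_, rfl,
      fun i hi => by simp [Function.update_of_ne hi.ne], ?_⟩
    · split_ifs <;> simp [Expr.cost, cost]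
    · split_ifs with h
      · simp [Expr.eval, eval, h]
      · simp [Expr.eval, eval, h]
  | read a iha =>
    intro ρ L s hL hρ
    obtain ⟨s₁, t₁, e₁, ht₁, hm₁, hr₁, hv₁⟩ := iha ρ L s hL hρ
    refine ⟨_, _, Exec.seq e₁ (Exec.assign s₁ L _), ?_, hm₁, ?_, ?_⟩
    · simp only [Expr.cost, cost]; omega
    · intro i hi
      simp [Function.update_of_ne hi.ne, hr₁ i hi]
    · simp [Expr.eval, eval, hv₁, hm₁]
  | add a b iha ihb =>
    intro ρ L s hL hρ
    obtain ⟨s₁, t₁, e₁, ht₁, hm₁, hr₁, hv₁⟩ := iha ρ L s hL hρ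
    obtain ⟨s₂, t₂, e₂, ht₂, hm₂, hr₂, hv₂⟩ := ihb ρ (L + 1) s₁ (by omega)
      fun x hx => (hρ x hx).trans (Nat.lt_succ_self L)
    rw [hr₁ 4 hL, hm₁, key ρ L s s₁ hρ hr₁] at hv₂
    rw [hr₁ 4 hL] at ht₂
    refine ⟨_, _, Exec.seq e₁ (Exec.seq e₂ (Exec.assign s₂ L _)), ?_, hm₂.trans hm₁, ?_, ?_⟩
    · simp only [Expr.cost, cost]; omega
    · intro i hi
      simp only [Function.update_of_ne hi.ne]
      rw [hr₂ i (by omega), hr₁ i hi]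
    · simp [Expr.eval, eval, hv₂, hr₂ L (by omega), hv₁]
  | sub a b iha ihb =>
    intro ρ L s hL hρ
    obtain ⟨s₁, t₁, e₁, ht₁, hm₁, hr₁, hv₁⟩ := iha ρ L s hL hρ
    obtain ⟨s₂, t₂, e₂, ht₂, hm₂, hr₂, hv₂⟩ := ihb ρ (L + 1) s₁ (by omega)
      fun x hx => (hρ x hx).trans (Nat.lt_succ_self L)
    rw [hr₁ 4 hL, hm₁, key ρ L s s₁ hρ hr₁] at hv₂
    rw [hr₁ 4 hL] at ht₂
    refine ⟨_, _, Exec.seq e₁ (Exec.seq e₂ (Exec.assign s₂ L _)), ?_, hm₂.trans hm₁, ?_, ?_⟩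
    · simp only [Expr.cost, cost]; omega
    · intro i hi
      simp only [Function.update_of_ne hi.ne]
      rw [hr₂ i (by omega), hr₁ i hi]
    · simp [Expr.eval, eval, hv₂, hr₂ L (by omega), hv₁]
  | ite c a b ihc iha ihb =>
    intro ρ L s hL hρ
    obtain ⟨s₁, t₁, e₁, ht₁, hm₁, hr₁, hv₁⟩ := ihc ρ L s hL hρ
    by_cases h : c.eval (s.reg 4) s.mem (ρ.map s.reg) = 0
    · obtain ⟨s₂, t₂, e₂, ht₂, hm₂, hr₂, hv₂⟩ := ihb ρ L s₁ hL hρ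
      rw [hr₁ 4 hL, hm₁, key ρ L s s₁ hρ hr₁] at hv₂
      rw [hr₁ 4 hL] at ht₂
      refine ⟨_, _, Exec.seq e₁ (Exec.ite_neg (by simpa [Expr.eval, hv₁] using h) e₂), ?_,
        hm₂.trans hm₁, fun i hi => (hr₂ i hi).trans (hr₁ i hi), ?_⟩
      · simp only [Expr.cost, cost]; omega
      · simp [hv₂, eval, h]
    · obtain ⟨s₂, t₂, e₂, ht₂, hm₂, hr₂, hv₂⟩ := iha ρ L s₁ hL hρ
      rw [hr₁ 4 hL, hm₁, key ρ L s s₁ hρ hr₁] at hv₂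
      rw [hr₁ 4 hL] at ht₂
      refine ⟨_, _, Exec.seq e₁ (Exec.ite_pos (by simpa [Expr.eval, hv₁] using h) e₂), ?_,
        hm₂.trans hm₁, fun i hi => (hr₂ i hi).trans (hr₁ i hi), ?_⟩
      · simp only [Expr.cost, cost]; omega
      · simp [hv₂, eval, h]
  | fold N x f ihN ihx ihf =>
    intro ρ L s hL hρ
    obtain ⟨s₁, t₁, e₁, ht₁, hm₁, hr₁, hv₁⟩ := ihN ρ L s hL hρ
    have e₂ := Exec.assign s₁ L (.minus (.reg L) (.minus (.reg L) (.reg 4)))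
    set s₂ : State :=
      { s₁ with
        reg := Function.update s₁.reg L
          ((Expr.minus (.reg L) (.minus (.reg L) (.reg 4))).eval s₁) } with hs₂
    have hr₂ : ∀ i < L, s₂.reg i = s.reg i := fun i hi => by
      simp [hs₂, Function.update_of_ne hi.ne, hr₁ i hi]
    have hv₂ : s₂.reg L = min (N.eval (s.reg 4) s.mem (ρ.map s.reg)) (s.reg 4) := by
      simp only [hs₂, Expr.eval, Function.update_self, hv₁, hr₁ 4 hL]
      omega
    have hm₂ : s₂.mem = s.mem := hm₁
    obtain ⟨s₃, t₃, e₃, ht₃, hm₃, hr₃, hv₃⟩ := ihx ρ (L + 1) s₂ (by omega)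
      fun x hx => (hρ x hx).trans (Nat.lt_succ_self L)
    rw [hr₂ 4 hL, hm₂, key ρ L s s₂ hρ hr₂] at hv₃
    rw [hr₂ 4 hL] at ht₃
    have e₄ := Exec.assign s₃ (L + 2) (.const 0)
    set s₄ : State :=
      { s₃ with reg := Function.update s₃.reg (L + 2) ((Expr.const 0).eval s₃) } with hs₄
    have hr₄ : ∀ i < L + 2, s₄.reg i = s₃.reg i := fun i hi => by
      simp [hs₄, Function.update_of_ne hi.ne]
    obtain ⟨s₅, t₅, e₅, ht₅, hm₅, hr₅, hv₅⟩ := exec_loop (f := f) (ρ := ρ) (L := L)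
      (C := f.cost (s.reg 4)) (M := s.mem) (reg := s.reg)
      (g := fun i y => f.eval (s.reg 4) s.mem (ρ.map s.reg ++ [i, y]))
      (x := x.eval (s.reg 4) s.mem (ρ.map s.reg))
      (N := min (N.eval (s.reg 4) s.mem (ρ.map s.reg)) (s.reg 4))
      (by
        intro s' hM' hr'
        have := ihf (ρ ++ [L + 2, L + 1]) (L + 3) s' (by omega) (by
          intro y hy
          simp only [List.mem_append, List.mem_cons, List.not_mem_nil, or_false] at hy
          rcases hy with hy | hy | hy
          · have := hρ y hy; omega
          · omega
          · omega)
        rw [hr' 4 hL, hM', List.map_append, key ρ L s s' hρ hr'] at this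
        simpa using this)
      _ s₄ 0 (by simp [hs₄, hm₃, hm₂])
      (fun j hj => by rw [hr₄ j (by omega), hr₃ j (by omega), hr₂ j hj])
      (Nat.zero_add _)
      (by rw [hr₄ L (by omega), hr₃ L (by omega), hv₂])
      (by simp [hs₄, Expr.eval])
      (by rw [hr₄ (L + 1) (by omega), hv₃, iterFrom])
    refine ⟨_, _, Exec.seq e₁ (Exec.seq e₂ (Exec.seq e₃ (Exec.seq e₄ (Exec.seq e₅
      (Exec.assign s₅ L _))))), ?_, hm₅, ?_, ?_⟩
    · have hmin : min (N.eval (s.reg 4) s.mem (ρ.map s.reg)) (s.reg 4) *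
          (f.cost (s.reg 4) + 10) ≤ s.reg 4 * (f.cost (s.reg 4) + 10) :=
        Nat.mul_le_mul_right _ (min_le_right _ _)
      simp only [Expr.cost, cost]
      omega
    · intro i hi
      simp only [Function.update_of_ne hi.ne]
      exact hr₅ i hi
    · simp only [Expr.eval, Function.update_self, eval]
      exact hv₅
  | @call n args f iha ihf =>
    intro ρ L s hL hρ
    obtain ⟨s₁, t₁, e₁, ht₁, hm₁, hr₁, hv₁⟩ := exec_args (n := n) (args := args) (ρ := ρ) (L := L)
      (B := s.reg 4) (M := s.mem) (reg := s.reg)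
      (by
        intro i s' hM' hr'
        have := iha i ρ (L + i) s' (by omega) fun x hx => (hρ x hx).trans_le (Nat.le_add_right _ _)
        rwa [hr' 4 hL, hM', key ρ L s s' hρ hr'] at this)
      n le_rfl s rfl fun _ _ => rfl
    obtain ⟨s₂, t₂, e₂, ht₂, hm₂, hr₂, hv₂⟩ := ihf (List.ofFn fun i : Fin n => L + i) (L + n) s₁
      (by omega) (by
        intro x hx
        obtain ⟨i, rfl⟩ := (List.mem_ofFn' _ _).1 hx
        simp)
    rw [hr₁ 4 hL, hm₁] at hv₂
    rw [hr₁ 4 hL] at ht₂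
    refine ⟨_, _, Exec.seq e₁ (Exec.seq e₂ (Exec.assign s₂ L _)), ?_, hm₂.trans hm₁, ?_, ?_⟩
    · have : ∑ i, (args i).cost (s.reg 4) = ∑ i ∈ Finset.range n,
          if h : i < n then (args ⟨i, h⟩).cost (s.reg 4) else 0 := by
        rw [Finset.sum_fin_eq_sum_range]
      simp only [Expr.cost, cost]
      omega
    · intro i hi
      simp only [Function.update_of_ne hi.ne]
      rw [hr₂ i (by omega), hr₁ i hi]
    · simp only [Expr.eval, Function.update_self, eval, hv₂, List.map_ofFn]
      congr 2
      funext i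
      exact hv₁ i i.2

/-- The running time of a term is polynomial in the cut-off. -/
theorem Term.cost_le (t : Term) : ∃ C d : ℕ, ∀ B, t.cost B ≤ C * (B + 1) ^ d := by
  have one : ∀ B d : ℕ, 1 ≤ (B + 1) ^ d := fun B d => Nat.one_le_pow _ _ (Nat.succ_pos B)
  have up : ∀ {C d C' d' B : ℕ}, C ≤ C' → d ≤ d' → C * (B + 1) ^ d ≤ C' * (B + 1) ^ d' :=
    fun hC hd => Nat.mul_le_mul hC (Nat.pow_le_pow_right (Nat.succ_pos _) hd)
  induction t with
  | const c => exact ⟨2, 0, by simp [cost]⟩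
  | var i => exact ⟨2, 0, by simp [cost]⟩
  | read a ih =>
    obtain ⟨C, d, h⟩ := ih
    refine ⟨C + 3, d, fun B => ?_⟩
    have := h B; have := one B d
    simp only [cost]; nlinarith
  | add a b iha ihb =>
    obtain ⟨C, d, h⟩ := iha
    obtain ⟨C', d', h'⟩ := ihb
    refine ⟨C + C' + 4, d + d', fun B => ?_⟩
    have h₁ := (h B).trans (up le_rfl (Nat.le_add_right d d'))
    have h₂ := (h' B).trans (up le_rfl (Nat.le_add_left d' d))
    have := one B (d + d')
    simp only [cost]; nlinarith
  | sub a b iha ihb =>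
    obtain ⟨C, d, h⟩ := iha
    obtain ⟨C', d', h'⟩ := ihb
    refine ⟨C + C' + 4, d + d', fun B => ?_⟩
    have h₁ := (h B).trans (up le_rfl (Nat.le_add_right d d'))
    have h₂ := (h' B).trans (up le_rfl (Nat.le_add_left d' d))
    have := one B (d + d')
    simp only [cost]; nlinarith
  | ite c a b ihc iha ihb =>
    obtain ⟨C, d, h⟩ := ihc
    obtain ⟨C', d', h'⟩ := iha
    obtain ⟨C'', d'', h''⟩ := ihb
    refine ⟨C + C' + C'' + 2, d + d' + d'', fun B => ?_⟩
    have h₁ := (h B).trans (up (d' := d + d' + d'') le_rfl (by omega))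
    have h₂ := (h' B).trans (up (d' := d + d' + d'') le_rfl (by omega))
    have h₃ := (h'' B).trans (up (d' := d + d' + d'') le_rfl (by omega))
    have := one B (d + d' + d'')
    simp only [cost]; nlinarith
  | fold N x f ihN ihx ihf =>
    obtain ⟨C, d, h⟩ := ihN
    obtain ⟨C', d', h'⟩ := ihx
    obtain ⟨C'', d'', h''⟩ := ihf
    refine ⟨C + C' + C'' + 24, d + d' + d'' + 1, fun B => ?_⟩
    have h₁ := (h B).trans (up (d' := d + d' + d'' + 1) le_rfl (by omega))
    have h₂ := (h' B).trans (up (d' := d + d' + d'' + 1) le_rfl (by omega))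
    have h₃ : B * (f.cost B + 10) ≤ (C'' + 10) * (B + 1) ^ (d + d' + d'' + 1) := by
      have h₄ := (h'' B).trans (up (d' := d + d' + d'') le_rfl (by omega))
      have h₅ : f.cost B + 10 ≤ (C'' + 10) * (B + 1) ^ (d + d' + d'') := by
        have := one B (d + d' + d'')
        nlinarith
      calc B * (f.cost B + 10) ≤ (B + 1) * ((C'' + 10) * (B + 1) ^ (d + d' + d'')) :=
            Nat.mul_le_mul (Nat.le_succ B) h₅
        _ = _ := by ring
    have := one B (d + d' + d'' + 1)
    simp only [cost]; nlinarith
  | @call n args f iha ihf =>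
    choose C d h using iha
    obtain ⟨C', d', h'⟩ := ihf
    refine ⟨(∑ i, C i) + C' + 3, (∑ i, d i) + d', fun B => ?_⟩
    have h₁ : ∑ i, (args i).cost B ≤ (∑ i, C i) * (B + 1) ^ ((∑ i, d i) + d') := by
      rw [Finset.sum_mul]
      refine Finset.sum_le_sum fun i _ => (h i B).trans (up le_rfl ?_)
      exact (Finset.single_le_sum (fun j _ => Nat.zero_le (d j)) (Finset.mem_univ i)).trans
        (Nat.le_add_right _ _)
    have h₂ := (h' B).trans (up le_rfl (Nat.le_add_left d' (∑ i, d i)))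
    have := one B ((∑ i, d i) + d')
    simp only [cost]; nlinarith

end RAM

/-! ### Guesses and their test -/

namespace BoolRank

open RAM

/-- The digit of `Y` at position `i`, in base `b`. -/
def digit (b Y i : ℕ) : ℕ := Y / b ^ i % b

/-- The lines `i` and `i'` (rows or columns) of the matrix `a` agree in their first `len`
entries. -/
def LineEq (a : ℕ → ℕ → ℕ) (len i i' : ℕ) : Prop := ∀ j < len, a i j = a i' j

instance (a : ℕ → ℕ → ℕ) (len i i' : ℕ) : Decidable (LineEq a len i i') := by
  unfold LineEq; infer_instance

/-- The line `i` is the first one of its kind. -/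
def IsLeader (a : ℕ → ℕ → ℕ) (len i : ℕ) : Prop := ∀ i' < i, ¬ LineEq a len i' i

instance (a : ℕ → ℕ → ℕ) (len i : ℕ) : Decidable (IsLeader a len i) := by
  unfold IsLeader; infer_instance

/-- The line `i` is equal to the leader number `ρ`, the first `cnt` lines being considered. -/
def InClass (a : ℕ → ℕ → ℕ) (len cnt ρ i : ℕ) : Prop :=
  ∃ i₀ < cnt, IsLeader a len i₀ ∧ Nat.count (IsLeader a len) i₀ = ρ ∧ LineEq a len i₀ i

instance (a : ℕ → ℕ → ℕ) (len cnt ρ i : ℕ) : Decidable (InClass a len cnt ρ i) := by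
  unfold InClass; infer_instance

/-- The entry of the Boolean product at a row of type `u` and a column of type `v`, where the
subsets of `{0, …, r - 1}` are encoded by their characteristic numbers in binary. -/
def entry (r u v : ℕ) : ℕ := if ∃ l < r, digit 2 u l ≠ 0 ∧ digit 2 v l ≠ 0 then 1 else 0

/-- A guess for an `m × n` matrix `a`: for every type `T < 2 ^ r`, the number `Y` has (in base
`b`) one digit for a class of equal columns and `s` digits for classes of equal rows, and `Z` has
(in base `2 ^ r`) one digit for the type of each column that is far from all guessed centers. -/
structure Guess where
  a : ℕ → ℕ → ℕ
  m : ℕ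
  n : ℕ
  r : ℕ
  s : ℕ
  b : ℕ
  Y : ℕ
  Z : ℕ

namespace Guess

variable (G : Guess)

/-- The column `j` belongs to the class of columns guessed for the type `T`. -/
def Chosen (T j : ℕ) : Prop :=
  InClass (fun j i => G.a i j) G.m G.n (digit G.b G.Y (T * (G.s + 1))) j

instance (T j : ℕ) : Decidable (G.Chosen T j) := by unfold Chosen; infer_instance

/-- A center is guessed for the type `T`: the column digit for `T` is the number of a class. -/
def Live (T : ℕ) : Prop := ∃ j < G.n, G.Chosen T j

instance (T : ℕ) : Decidable (G.Live T) := by unfold Live; infer_instance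

/-- The entry in row `i` of the column guessed for `T` is not zero. -/
def Val (T i : ℕ) : Prop := ∃ j < G.n, G.Chosen T j ∧ G.a i j ≠ 0

instance (T i : ℕ) : Decidable (G.Val T i) := by unfold Val; infer_instance

/-- The row `i` belongs to a class in which the column guessed for `T` is to be changed. -/
def Flip (T i : ℕ) : Prop :=
  ∃ q < G.s, InClass G.a G.n G.m (digit G.b G.Y (T * (G.s + 1) + 1 + q)) i

instance (T i : ℕ) : Decidable (G.Flip T i) := by unfold Flip; infer_instance

/-- The guessed center of the type `T`. -/
def center (T i : ℕ) : ℕ := if (G.Val T i ↔ G.Flip T i) then 0 else 1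

/-- The distance of the column `j` from the guessed center of the type `T`. -/
def dist (T j : ℕ) : ℕ := Nat.count (fun i => G.center T i ≠ G.a i j) G.m

/-- The distance from a guessed center, made larger than `s` where none is guessed. -/
def score (T j : ℕ) : ℕ := if G.Live T then G.dist T j else G.s + 1

/-- A type of least score for the column `j`. -/
def best (j : ℕ) : ℕ :=
  iterFrom (fun T y => if G.score T j < G.score y j then T else y) 0 (2 ^ G.r)

/-- The column `j` is at distance at most `s` from a guessed center. -/
def Near (j : ℕ) : Prop := G.score (G.best j) j ≤ G.s

instance (j : ℕ) : Decidable (G.Near j) := by unfold Near; infer_instance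

/-- The type given to the column `j`: that of the nearest guessed center for a near column, and
the next unused digit of `Z` for a far one. -/
def colType (j : ℕ) : ℕ :=
  if G.Near j then G.best j else digit (2 ^ G.r) G.Z (Nat.count (fun j => ¬ G.Near j) j)

/-- The number of changes in row `i`, if the row is given the type `u`. -/
def mismatch (u i : ℕ) : ℕ := Nat.count (fun j => entry G.r u (G.colType j) ≠ G.a i j) G.n

/-- The number of changes in row `i`, if the row is given its best type. -/
def rowCost (i : ℕ) : ℕ := iterFrom (fun u y => min y (G.mismatch u i)) G.n (2 ^ G.r)

/-- The number of changes, for the best types of all rows. -/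
def total : ℕ := ∑ i ∈ Finset.range G.m, G.rowCost i

theorem best_lt (j : ℕ) : G.best j < 2 ^ G.r := by
  have : ∀ N, iterFrom (fun T y => if G.score T j < G.score y j then T else y) 0 N
      ≤ N - 1 := by
    intro N
    induction N with
    | zero => simp [iterFrom]
    | succ N ih =>
      simp only [iterFrom]
      split_ifs <;> omega
  have h := this (2 ^ G.r)
  have := Nat.two_pow_pos G.r
  unfold best
  omega

theorem colType_lt (j : ℕ) : G.colType j < 2 ^ G.r := by
  unfold colType
  split_ifs
  · exact G.best_lt j
  · exact Nat.mod_lt _ (Nat.two_pow_pos _)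

end Guess

end BoolRank

/-! ### Terms for arithmetic, conditions and lines of a matrix -/

namespace RAM.Term

open BoolRank

/-- The condition `a ≤ b`. A term serves as a condition, which holds if the value is not `0`. -/
def tle (a b : Term) : Term := .sub (.const 1) (.sub a b)

/-- `a ≠ b` -/
def tne (a b : Term) : Term := .add (.sub a b) (.sub b a)

/-- The negation of the condition `a`. -/
def tnot (a : Term) : Term := .sub (.const 1) a

/-- `a = b` -/
def teq (a b : Term) : Term := tnot (tne a b)

/-- The conjunction of the conditions `a` and `b`. -/
def tand (a b : Term) : Term := .ite a b (.const 0)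

/-- The sum of `f` over `i < N`. In this term and in the following ones, `L` is the length of the
environment, so that `f` finds `i` in the variable `L`. -/
def tsum (L : ℕ) (N f : Term) : Term := .fold N (.const 0) (.add (.var (L + 1)) f)

/-- The number of `i < N` for which the condition `c` holds. -/
def tcount (L : ℕ) (N c : Term) : Term := tsum L N (.ite c (.const 1) (.const 0))

/-- Some `i < N` satisfies the condition `c`. -/
def tex (L : ℕ) (N c : Term) : Term := tsum L N c

/-- All `i < N` satisfy the condition `c`. -/
def tall (L : ℕ) (N c : Term) : Term := tnot (tex L N (tnot c))

variable {B : ℕ} {M : ℕ → ℕ} {e : List ℕ}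

theorem eval_add {a b : Term} :
    (add a b).eval B M e = a.eval B M e + b.eval B M e := rfl

theorem eval_sub {a b : Term} :
    (sub a b).eval B M e = a.eval B M e - b.eval B M e := rfl

theorem eval_tle {a b : Term} :
    (tle a b).eval B M e ≠ 0 ↔ a.eval B M e ≤ b.eval B M e := by
  simp only [tle, eval]; omega

theorem eval_tne {a b : Term} :
    (tne a b).eval B M e ≠ 0 ↔ a.eval B M e ≠ b.eval B M e := by
  simp only [tne, eval]; omega

theorem eval_tnot {a : Term} : (tnot a).eval B M e ≠ 0 ↔ ¬ a.eval B M e ≠ 0 := by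
  simp only [tnot, eval]; omega

theorem eval_teq {a b : Term} :
    (teq a b).eval B M e ≠ 0 ↔ a.eval B M e = b.eval B M e := by
  simp only [teq, eval_tnot, eval_tne, not_not]

theorem eval_tand {a b : Term} :
    (tand a b).eval B M e ≠ 0 ↔ a.eval B M e ≠ 0 ∧ b.eval B M e ≠ 0 := by
  simp only [tand, eval]
  split_ifs with h <;> simp [h]

theorem eval_tsum {L : ℕ} {N f : Term} {g : ℕ → ℕ} {k : ℕ} (hL : e.length = L)
    (hk : N.eval B M e = k) (hN : k ≤ B)
    (h : ∀ i < k, ∀ y, f.eval B M (e ++ [i, y]) = g i) :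
    (tsum L N f).eval B M e = ∑ i ∈ Finset.range k, g i := by
  subst hL
  have key : ∀ j ≤ k, iterFrom (fun i y => (Term.add (.var (e.length + 1)) f).eval B M
      (e ++ [i, y])) 0 j = ∑ i ∈ Finset.range j, g i := by
    intro j hj
    induction j with
    | zero => rfl
    | succ j ih =>
      rw [iterFrom, ih (by omega), Finset.sum_range_succ]
      simp [eval, h j (by omega)]
  simp only [tsum, eval, hk, min_eq_left hN]
  exact key k le_rfl

theorem eval_tcount {L : ℕ} {N c : Term} {P : ℕ → Prop} [DecidablePred P] {k : ℕ}
    (hL : e.length = L) (hk : N.eval B M e = k) (hN : k ≤ B)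
    (h : ∀ i < k, ∀ y, (c.eval B M (e ++ [i, y]) ≠ 0 ↔ P i)) :
    (tcount L N c).eval B M e = Nat.count P k := by
  rw [tcount, eval_tsum (g := fun i => if P i then 1 else 0) hL hk hN, ← Finset.sum_filter,
    ← Finset.card_eq_sum_ones, Nat.count_eq_card_filter_range]
  intro i hi y
  simp only [eval, h i hi y]

theorem eval_tex {L : ℕ} {N c : Term} {P : ℕ → Prop} {k : ℕ}
    (hL : e.length = L) (hk : N.eval B M e = k) (hN : k ≤ B)
    (h : ∀ i < k, ∀ y, (c.eval B M (e ++ [i, y]) ≠ 0 ↔ P i)) :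
    (tex L N c).eval B M e ≠ 0 ↔ ∃ i < k, P i := by
  subst hL
  have key : ∀ j ≤ k, iterFrom (fun i y => (Term.add (.var (e.length + 1)) c).eval B M
      (e ++ [i, y])) 0 j ≠ 0 ↔ ∃ i < j, P i := by
    intro j hj
    induction j with
    | zero => simp [iterFrom]
    | succ j ih =>
      have ih := ih (by omega)
      have hj := fun y => h j (by omega) y
      simp only [iterFrom, eval]
      rw [Nat.exists_lt_succ_right, ← ih, ← hj (iterFrom (fun i y =>
        (Term.add (.var (e.length + 1)) c).eval B M (e ++ [i, y])) 0 j)]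
      simp [eval]
      tauto
  simp only [tex, tsum, eval, hk, min_eq_left hN]
  exact key k le_rfl

theorem eval_tall {L : ℕ} {N c : Term} {P : ℕ → Prop} {k : ℕ}
    (hL : e.length = L) (hk : N.eval B M e = k) (hN : k ≤ B)
    (h : ∀ i < k, ∀ y, (c.eval B M (e ++ [i, y]) ≠ 0 ↔ P i)) :
    (tall L N c).eval B M e ≠ 0 ↔ ∀ i < k, P i := by
  rw [tall, eval_tnot, eval_tex (P := fun i => ¬ P i) hL hk hN]
  · push Not; rfl
  · intro i hi y
    rw [eval_tnot, h i hi y]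

theorem eval_call_two {a₁ a₂ f : Term} {x₁ x₂ : ℕ} (h₁ : a₁.eval B M e = x₁)
    (h₂ : a₂.eval B M e = x₂) : (call ![a₁, a₂] f).eval B M e = f.eval B M [x₁, x₂] := by
  subst h₁ h₂; rfl

theorem eval_call_three {a₁ a₂ a₃ f : Term} {x₁ x₂ x₃ : ℕ} (h₁ : a₁.eval B M e = x₁)
    (h₂ : a₂.eval B M e = x₂) (h₃ : a₃.eval B M e = x₃) :
    (call ![a₁, a₂, a₃] f).eval B M e = f.eval B M [x₁, x₂, x₃] := by
  subst h₁ h₂ h₃; rfl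

/-- A prefix of the natural numbers is counted by its length. -/
theorem count_of_iff_lt {P : ℕ → Prop} [DecidablePred P] {N t : ℕ} (ht : t ≤ N)
    (h : ∀ i < N, (P i ↔ i < t)) : Nat.count P N = t := by
  rw [Nat.count_eq_card_filter_range, ← Finset.card_range t]
  congr 1
  ext i
  simp only [Finset.mem_filter, Finset.mem_range]
  constructor
  · rintro ⟨h₁, h₂⟩; exact (h i h₁).1 h₂
  · intro hi; exact ⟨hi.trans_le ht, (h i (hi.trans_le ht)).2 hi⟩

/-- `[x, y] ↦ x * y` -/
def mulT : Term := tsum 2 (.var 0) (.var 1)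

theorem eval_mulT {x y : ℕ} (hx : x ≤ B) : mulT.eval B M [x, y] = x * y := by
  refine (eval_tsum (g := fun _ => y) (k := x) rfl rfl hx fun _ _ _ => rfl).trans ?_
  simp

/-- `[Y, b] ↦ Y / b` -/
def divT : Term :=
  tcount 2 (.var 0) (tle (call ![.add (.var 2) (.const 1), .var 1] mulT) (.var 0))

theorem eval_divT {Y b : ℕ} (hY : Y ≤ B) (hb : 0 < b) : divT.eval B M [Y, b] = Y / b := by
  refine (eval_tcount (P := fun q => (q + 1) * b ≤ Y) rfl rfl hY fun q hq z => ?_).trans ?_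
  · change q < Y at hq
    rw [eval_tle, eval_call_two (x₁ := q + 1) rfl rfl, eval_mulT (by omega)]
    rfl
  · refine count_of_iff_lt (Nat.div_le_self _ _) fun q _ => ?_
    rw [← Nat.le_div_iff_mul_le hb, Nat.succ_le_iff]

/-- `[b, i] ↦ b ^ i` -/
def powT : Term := .fold (.var 1) (.const 1) (call ![.var 0, .var 3] mulT)

theorem eval_powT {b i : ℕ} (hb : b ≤ B) (hi : i ≤ B) : powT.eval B M [b, i] = b ^ i := by
  have key : ∀ j, iterFrom (fun j y => (call ![.var 0, .var 3] mulT).eval B M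
      ([b, i] ++ [j, y])) 1 j = b ^ j := by
    intro j
    induction j with
    | zero => rfl
    | succ j ih =>
      rw [iterFrom, ih, eval_call_two (x₁ := b) (x₂ := b ^ j) rfl rfl, eval_mulT hb, pow_succ']
  simp only [powT, eval]
  exact (congrArg _ (min_eq_left hi)).trans (key i)

/-- `[b, Y, i] ↦ digit b Y i` -/
def digitT : Term :=
  call ![call ![.var 1, call ![.var 0, .var 2] powT] divT, .var 0]
    (.sub (.var 0) (call ![.var 1, call ![.var 0, .var 1] divT] mulT))

theorem eval_digitT {b Y i : ℕ} (hb : b ≤ B) (hb' : 0 < b) (hY : Y ≤ B) (hi : i ≤ B) :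
    digitT.eval B M [b, Y, i] = digit b Y i := by
  have hD : Y / b ^ i ≤ B := (Nat.div_le_self _ _).trans hY
  have h₁ : (call ![.var 0, .var 2] powT).eval B M [b, Y, i] = b ^ i :=
    (eval_call_two rfl rfl).trans (eval_powT hb hi)
  have h₂ : (call ![.var 1, call ![.var 0, .var 2] powT] divT).eval B M [b, Y, i] = Y / b ^ i :=
    (eval_call_two rfl h₁).trans (eval_divT hY (pow_pos hb' i))
  have h₃ : (call ![.var 0, .var 1] divT).eval B M [Y / b ^ i, b] = Y / b ^ i / b :=
    (eval_call_two rfl rfl).trans (eval_divT hD hb')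
  have h₄ : (call ![.var 1, call ![.var 0, .var 1] divT] mulT).eval B M [Y / b ^ i, b] =
      b * (Y / b ^ i / b) := (eval_call_two rfl h₃).trans (eval_mulT hb)
  rw [digitT, eval_call_two (x₂ := b) h₂ rfl, eval, h₄, digit, Nat.mod_def]
  rfl

theorem eval_call_four {a₁ a₂ a₃ a₄ f : Term} {x₁ x₂ x₃ x₄ : ℕ} (h₁ : a₁.eval B M e = x₁)
    (h₂ : a₂.eval B M e = x₂) (h₃ : a₃.eval B M e = x₃) (h₄ : a₄.eval B M e = x₄) :
    (call ![a₁, a₂, a₃, a₄] f).eval B M e = f.eval B M [x₁, x₂, x₃, x₄] := by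
  subst h₁ h₂ h₃ h₄; rfl

theorem eval_call_five {a₁ a₂ a₃ a₄ a₅ f : Term} {x₁ x₂ x₃ x₄ x₅ : ℕ}
    (h₁ : a₁.eval B M e = x₁) (h₂ : a₂.eval B M e = x₂) (h₃ : a₃.eval B M e = x₃)
    (h₄ : a₄.eval B M e = x₄) (h₅ : a₅.eval B M e = x₅) :
    (call ![a₁, a₂, a₃, a₄, a₅] f).eval B M e = f.eval B M [x₁, x₂, x₃, x₄, x₅] := by
  subst h₁ h₂ h₃ h₄ h₅; rfl

theorem eval_call_six {a₁ a₂ a₃ a₄ a₅ a₆ f : Term} {x₁ x₂ x₃ x₄ x₅ x₆ : ℕ}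
    (h₁ : a₁.eval B M e = x₁) (h₂ : a₂.eval B M e = x₂) (h₃ : a₃.eval B M e = x₃)
    (h₄ : a₄.eval B M e = x₄) (h₅ : a₅.eval B M e = x₅) (h₆ : a₆.eval B M e = x₆) :
    (call ![a₁, a₂, a₃, a₄, a₅, a₆] f).eval B M e = f.eval B M [x₁, x₂, x₃, x₄, x₅, x₆] := by
  subst h₁ h₂ h₃ h₄ h₅ h₆; rfl

/-- `[α, β, i, j] ↦` the memory cell `α * i + β * j`: entry `j` of line `i` -/
def cellT : Term :=
  .read (.add (call ![.var 0, .var 2] mulT) (call ![.var 1, .var 3] mulT))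

theorem eval_cellT {α β i j : ℕ} (hα : α ≤ B) (hβ : β ≤ B) :
    cellT.eval B M [α, β, i, j] = M (α * i + β * j) := by
  rw [cellT, eval, eval, eval_call_two (x₁ := α) (x₂ := i) rfl rfl,
    eval_call_two (x₁ := β) (x₂ := j) rfl rfl, eval_mulT hα, eval_mulT hβ]

/-- `[α, β, len, i, i'] ↦` whether the lines `i` and `i'` are equal -/
def lineEqT : Term :=
  tall 5 (.var 2) (teq (call ![.var 0, .var 1, .var 3, .var 5] cellT)
    (call ![.var 0, .var 1, .var 4, .var 5] cellT))

theorem eval_lineEqT {α β len i i' : ℕ} (hα : α ≤ B) (hβ : β ≤ B) (hlen : len ≤ B) :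
    lineEqT.eval B M [α, β, len, i, i'] ≠ 0 ↔
      LineEq (fun i j => M (α * i + β * j)) len i i' := by
  refine (eval_tall (k := len) rfl rfl hlen fun j _ z => ?_)
  rw [eval_teq, eval_call_four (x₁ := α) (x₂ := β) (x₃ := i) (x₄ := j) rfl rfl rfl rfl,
    eval_call_four (x₁ := α) (x₂ := β) (x₃ := i') (x₄ := j) rfl rfl rfl rfl,
    eval_cellT hα hβ, eval_cellT hα hβ]

/-- `[α, β, len, i] ↦` whether the line `i` is the first one of its kind -/
def leaderT : Term :=
  tall 4 (.var 3) (tnot (call ![.var 0, .var 1, .var 2, .var 4, .var 3] lineEqT))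

theorem eval_leaderT {α β len i : ℕ} (hα : α ≤ B) (hβ : β ≤ B) (hlen : len ≤ B) (hi : i ≤ B) :
    leaderT.eval B M [α, β, len, i] ≠ 0 ↔
      IsLeader (fun i j => M (α * i + β * j)) len i := by
  refine (eval_tall (k := i) rfl rfl hi fun i' _ z => ?_)
  rw [eval_tnot, eval_call_five (x₁ := α) (x₂ := β) (x₃ := len) (x₄ := i') (x₅ := i)
    rfl rfl rfl rfl rfl, eval_lineEqT hα hβ hlen]

/-- `[α, β, len, i] ↦` the number of leaders before the line `i` -/
def rankT : Term :=
  tcount 4 (.var 3) (call ![.var 0, .var 1, .var 2, .var 4] leaderT)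

theorem eval_rankT {α β len i : ℕ} (hα : α ≤ B) (hβ : β ≤ B) (hlen : len ≤ B) (hi : i ≤ B) :
    rankT.eval B M [α, β, len, i] =
      Nat.count (IsLeader (fun i j => M (α * i + β * j)) len) i := by
  refine (eval_tcount (k := i) rfl rfl hi fun i' hi' z => ?_)
  rw [eval_call_four (x₁ := α) (x₂ := β) (x₃ := len) (x₄ := i') rfl rfl rfl rfl,
    eval_leaderT hα hβ hlen (by omega)]

/-- `[α, β, len, cnt, ρ, i] ↦` whether the line `i` belongs to the class `ρ` -/
def inClassT : Term :=
  tex 6 (.var 3) (tand (call ![.var 0, .var 1, .var 2, .var 6] leaderT)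
    (tand (teq (call ![.var 0, .var 1, .var 2, .var 6] rankT) (.var 4))
      (call ![.var 0, .var 1, .var 2, .var 6, .var 5] lineEqT)))

theorem eval_inClassT {α β len cnt ρ i : ℕ} (hα : α ≤ B) (hβ : β ≤ B) (hlen : len ≤ B)
    (hcnt : cnt ≤ B) :
    inClassT.eval B M [α, β, len, cnt, ρ, i] ≠ 0 ↔
      InClass (fun i j => M (α * i + β * j)) len cnt ρ i := by
  refine (eval_tex (k := cnt) rfl rfl hcnt fun i₀ hi₀ z => ?_)
  rw [eval_tand, eval_tand, eval_teq,
    eval_call_four (x₁ := α) (x₂ := β) (x₃ := len) (x₄ := i₀) rfl rfl rfl rfl,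
    eval_leaderT hα hβ hlen (by omega),
    eval_call_four (x₁ := α) (x₂ := β) (x₃ := len) (x₄ := i₀) rfl rfl rfl rfl,
    eval_rankT hα hβ hlen (by omega),
    eval_call_five (x₁ := α) (x₂ := β) (x₃ := len) (x₄ := i₀) (x₅ := i)
    rfl rfl rfl rfl rfl, eval_lineEqT hα hβ hlen]
  rfl

/-- `[r, u, v] ↦ entry r u v` -/
def entryT : Term :=
  .ite (tex 3 (.var 0) (tand (call ![.const 2, .var 1, .var 3] digitT)
    (call ![.const 2, .var 2, .var 3] digitT))) (.const 1) (.const 0)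

theorem eval_entryT {r u v : ℕ} (h2 : 2 ≤ B) (hr : r ≤ B) (hu : u ≤ B) (hv : v ≤ B) :
    entryT.eval B M [r, u, v] = entry r u v := by
  rw [entryT, eval, entry]
  refine if_congr (eval_tex (k := r) rfl rfl hr fun l hl z => ?_) rfl rfl
  rw [eval_tand, eval_call_three (x₁ := 2) (x₂ := u) (x₃ := l) rfl rfl rfl,
    eval_call_three (x₁ := 2) (x₂ := v) (x₃ := l) rfl rfl rfl,
    eval_digitT h2 two_pos hu (by omega), eval_digitT h2 two_pos hv (by omega)]

end RAM.Term

/-! ### Terms for the test of a guess -/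

namespace BoolRank.Guess

open RAM RAM.Term

/-- The environment that holds a guess. -/
def env (G : Guess) : List ℕ := [G.m, G.n, G.r, 2 ^ G.r, G.s, G.b, G.Y, G.Z]

/-- The memory `M` holds the matrix, and all the numbers that occur in the test of the guess `G`
are below the cut-off `B`. -/
structure Fits (G : Guess) (B : ℕ) (M : ℕ → ℕ) : Prop where
  mem : ∀ i j, G.a i j = M (G.n * i + j)
  two : 2 ≤ B
  m : G.m ≤ B
  n : G.n ≤ B
  r : G.r ≤ B
  types : 2 ^ G.r ≤ B
  s : G.s ≤ B
  b_pos : 0 < G.b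
  b : G.b ≤ B
  Y : G.Y ≤ B
  Z : G.Z ≤ B
  digits : 2 ^ G.r * (G.s + 1) ≤ B

/-- The call of a term with the guess and one more argument. -/
def callWith (f x : Term) : Term :=
  .call ![.var 0, .var 1, .var 2, .var 3, .var 4, .var 5, .var 6, .var 7, x] f

/-- The call of a term with the guess and two more arguments. -/
def callWith₂ (f x y : Term) : Term :=
  .call ![.var 0, .var 1, .var 2, .var 3, .var 4, .var 5, .var 6, .var 7, x, y] f

variable {G : Guess} {B : ℕ} {M : ℕ → ℕ} {e : List ℕ}

theorem eval_callWith {f x : Term} {v : ℕ} (he : e.take 8 = G.env) (hx : x.eval B M e = v) :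
    (callWith f x).eval B M e = f.eval B M (G.env ++ [v]) := by
  subst hx
  have h : ∀ i < 8, e.getD i 0 = G.env.getD i 0 := by
    intro i hi
    rw [← he]
    simp [List.getD_eq_getElem?_getD, hi]
  refine congrArg (f.eval B M) ?_
  change [e.getD 0 0, e.getD 1 0, e.getD 2 0, e.getD 3 0, e.getD 4 0, e.getD 5 0, e.getD 6 0,
    e.getD 7 0, _] = _
  simp only [h 0 (by omega), h 1 (by omega), h 2 (by omega), h 3 (by omega), h 4 (by omega),
    h 5 (by omega), h 6 (by omega), h 7 (by omega)]
  rfl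

theorem eval_callWith₂ {f x y : Term} {v w : ℕ} (he : e.take 8 = G.env)
    (hx : x.eval B M e = v) (hy : y.eval B M e = w) :
    (callWith₂ f x y).eval B M e = f.eval B M (G.env ++ [v, w]) := by
  subst hx hy
  have h : ∀ i < 8, e.getD i 0 = G.env.getD i 0 := by
    intro i hi
    rw [← he]
    simp [List.getD_eq_getElem?_getD, hi]
  refine congrArg (f.eval B M) ?_
  change [e.getD 0 0, e.getD 1 0, e.getD 2 0, e.getD 3 0, e.getD 4 0, e.getD 5 0, e.getD 6 0,
    e.getD 7 0, _, _] = _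
  simp only [h 0 (by omega), h 1 (by omega), h 2 (by omega), h 3 (by omega), h 4 (by omega),
    h 5 (by omega), h 6 (by omega), h 7 (by omega)]
  rfl

/-- `[…, T, j] ↦` whether `G.Chosen T j` -/
def chosenT : Term :=
  call ![.const 1, .var 1, .var 0, .var 1,
    call ![.var 5, .var 6, call ![.var 8, .add (.var 4) (.const 1)] mulT] digitT, .var 9] inClassT

theorem Fits.eval_chosenT (h : G.Fits B M) {T j : ℕ} (hT : T < 2 ^ G.r) :
    chosenT.eval B M (G.env ++ [T, j]) ≠ 0 ↔ G.Chosen T j := by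
  have h₁ : (call ![.var 8, .add (.var 4) (.const 1)] mulT).eval B M (G.env ++ [T, j]) =
      T * (G.s + 1) :=
    (eval_call_two (x₁ := T) (x₂ := G.s + 1) rfl rfl).trans (eval_mulT (hT.le.trans h.types))
  have h₂ : (call ![.var 5, .var 6, call ![.var 8, .add (.var 4) (.const 1)] mulT] digitT).eval
      B M (G.env ++ [T, j]) = digit G.b G.Y (T * (G.s + 1)) :=
    (eval_call_three (x₁ := G.b) (x₂ := G.Y) rfl rfl h₁).trans
      (eval_digitT h.b h.b_pos h.Y ((Nat.mul_le_mul_right _ hT.le).trans h.digits))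
  rw [chosenT, eval_call_six (x₁ := 1) (x₂ := G.n) (x₃ := G.m) (x₄ := G.n) (x₆ := j)
    rfl rfl rfl rfl h₂ rfl, eval_inClassT (by have := h.two; omega) h.n h.m h.n, Chosen]
  have : (fun i j => M (1 * i + G.n * j)) = fun j i => G.a i j := by
    funext i j
    rw [h.mem, one_mul, add_comm]
  rw [this]

/-- `[…, T, i] ↦` whether `G.Flip T i` -/
def flipT : Term :=
  tex 10 (.var 4) (call ![.var 1, .const 1, .var 1, .var 0,
    call ![.var 5, .var 6, .add (.add (call ![.var 8, .add (.var 4) (.const 1)] mulT) (.const 1))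
      (.var 10)] digitT, .var 9] inClassT)

theorem Fits.eval_flipT (h : G.Fits B M) {T i : ℕ} (hT : T < 2 ^ G.r) :
    flipT.eval B M (G.env ++ [T, i]) ≠ 0 ↔ G.Flip T i := by
  refine eval_tex (k := G.s) rfl rfl h.s fun q hq z => ?_
  have h₁ : (call ![.var 8, .add (.var 4) (.const 1)] mulT).eval B M
      ((G.env ++ [T, i]) ++ [q, z]) = T * (G.s + 1) :=
    (eval_call_two (x₁ := T) (x₂ := G.s + 1) rfl rfl).trans (eval_mulT (hT.le.trans h.types))
  have h₂ : (Term.add (.add (call ![.var 8, .add (.var 4) (.const 1)] mulT) (.const 1))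
      (.var 10)).eval B M ((G.env ++ [T, i]) ++ [q, z]) = T * (G.s + 1) + 1 + q := by
    rw [eval_add, eval_add, h₁]; rfl
  have h₃ : T * (G.s + 1) + 1 + q ≤ B := by
    have : (T + 1) * (G.s + 1) ≤ 2 ^ G.r * (G.s + 1) := Nat.mul_le_mul_right _ hT
    have := h.digits
    nlinarith
  have h₄ := (eval_call_three (f := digitT) (a₁ := .var 5) (a₂ := .var 6)
    (x₁ := G.b) (x₂ := G.Y) rfl rfl h₂).trans
    (eval_digitT h.b h.b_pos h.Y h₃)
  rw [eval_call_six (x₁ := G.n) (x₂ := 1) (x₃ := G.n) (x₄ := G.m) (x₆ := i)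
    rfl rfl rfl rfl h₄ rfl, eval_inClassT h.n (by have := h.two; omega) h.n h.m]
  have : (fun i j => M (G.n * i + 1 * j)) = G.a := by
    funext i j
    rw [h.mem, one_mul]
  rw [this]

/-- `[…, T] ↦` whether `G.Live T` -/
def liveT : Term := tex 9 (.var 1) (callWith₂ chosenT (.var 8) (.var 9))

theorem Fits.eval_liveT (h : G.Fits B M) {T : ℕ} (hT : T < 2 ^ G.r) :
    liveT.eval B M (G.env ++ [T]) ≠ 0 ↔ G.Live T := by
  refine eval_tex (k := G.n) rfl rfl h.n fun j _ z => ?_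
  rw [eval_callWith₂ (G := G) (v := T) (w := j) rfl rfl rfl, h.eval_chosenT hT]

/-- `[…, i, j] ↦ G.a i j` -/
def matrixT : Term := call ![.var 1, .const 1, .var 8, .var 9] cellT

theorem Fits.eval_matrixT (h : G.Fits B M) {i j : ℕ} :
    matrixT.eval B M (G.env ++ [i, j]) = G.a i j := by
  rw [matrixT, eval_call_four (x₁ := G.n) (x₂ := 1) (x₃ := i) (x₄ := j) rfl rfl rfl rfl,
    eval_cellT h.n (by have := h.two; omega), h.mem, one_mul]

/-- `[…, T, i] ↦` whether `G.Val T i` -/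
def valT : Term :=
  tex 10 (.var 1) (tand (callWith₂ chosenT (.var 8) (.var 10))
    (callWith₂ matrixT (.var 9) (.var 10)))

theorem Fits.eval_valT (h : G.Fits B M) {T i : ℕ} (hT : T < 2 ^ G.r) :
    valT.eval B M (G.env ++ [T, i]) ≠ 0 ↔ G.Val T i := by
  refine eval_tex (k := G.n) rfl rfl h.n fun j _ z => ?_
  rw [eval_tand, eval_callWith₂ (G := G) (v := T) (w := j) rfl rfl rfl,
    eval_callWith₂ (G := G) (v := i) (w := j) rfl rfl rfl, h.eval_chosenT hT, h.eval_matrixT]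

/-- `[…, T, i] ↦ G.center T i` -/
def centerT : Term :=
  .ite (callWith₂ valT (.var 8) (.var 9))
    (.ite (callWith₂ flipT (.var 8) (.var 9)) (.const 0) (.const 1))
    (.ite (callWith₂ flipT (.var 8) (.var 9)) (.const 1) (.const 0))

theorem Fits.eval_centerT (h : G.Fits B M) {T i : ℕ} (hT : T < 2 ^ G.r) :
    centerT.eval B M (G.env ++ [T, i]) = G.center T i := by
  simp only [centerT, eval]
  rw [eval_callWith₂ (G := G) (v := T) (w := i) rfl rfl rfl,
    eval_callWith₂ (G := G) (v := T) (w := i) rfl rfl rfl, center]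
  simp only [h.eval_valT hT, h.eval_flipT hT]
  split_ifs <;> tauto

/-- `[…, T, j] ↦ G.dist T j` -/
def distT : Term :=
  tcount 10 (.var 0) (tne (callWith₂ centerT (.var 8) (.var 10))
    (callWith₂ matrixT (.var 10) (.var 9)))

theorem Fits.eval_distT (h : G.Fits B M) {T j : ℕ} (hT : T < 2 ^ G.r) :
    distT.eval B M (G.env ++ [T, j]) = G.dist T j := by
  refine eval_tcount (k := G.m) rfl rfl h.m fun i _ z => ?_
  rw [eval_tne, eval_callWith₂ (G := G) (v := T) (w := i) rfl rfl rfl,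
    eval_callWith₂ (G := G) (v := i) (w := j) rfl rfl rfl, h.eval_centerT hT, h.eval_matrixT]

/-- `[…, T, j] ↦ G.score T j` -/
def scoreT : Term :=
  .ite (callWith liveT (.var 8)) (callWith₂ distT (.var 8) (.var 9)) (.add (.var 4) (.const 1))

theorem Fits.eval_scoreT (h : G.Fits B M) {T j : ℕ} (hT : T < 2 ^ G.r) :
    scoreT.eval B M (G.env ++ [T, j]) = G.score T j := by
  rw [scoreT, eval, eval_callWith (G := G) (v := T) rfl rfl,
    eval_callWith₂ (G := G) (v := T) (w := j) rfl rfl rfl, h.eval_distT hT, score]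
  exact if_congr (h.eval_liveT hT) rfl rfl

/-- `[…, j] ↦ G.best j` -/
def bestT : Term :=
  .fold (.var 3) (.const 0) (.ite (.sub (callWith₂ scoreT (.var 10) (.var 8))
    (callWith₂ scoreT (.var 9) (.var 8))) (.var 9) (.var 10))

theorem Fits.eval_bestT (h : G.Fits B M) {j : ℕ} :
    bestT.eval B M (G.env ++ [j]) = G.best j := by
  have key : ∀ N ≤ 2 ^ G.r, iterFrom (fun T y =>
        (Term.ite (.sub (callWith₂ scoreT (.var 10) (.var 8))
          (callWith₂ scoreT (.var 9) (.var 8))) (.var 9) (.var 10)).eval B M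
          ((G.env ++ [j]) ++ [T, y])) 0 N =
        iterFrom (fun T y => if G.score T j < G.score y j then T else y) 0 N ∧
      iterFrom (fun T y => if G.score T j < G.score y j then T else y) 0 N < 2 ^ G.r := by
    intro N hN
    induction N with
    | zero => exact ⟨rfl, Nat.two_pow_pos _⟩
    | succ N ih =>
      obtain ⟨ih₁, ih₂⟩ := ih (by omega)
      simp only [iterFrom, ih₁]
      set y := iterFrom (fun T y => if G.score T j < G.score y j then T else y) 0 N
      constructor
      · rw [eval, eval_sub, eval_callWith₂ (G := G) (v := y) (w := j) rfl rfl rfl,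
          eval_callWith₂ (G := G) (v := N) (w := j) rfl rfl rfl, h.eval_scoreT ih₂,
          h.eval_scoreT (by omega)]
        exact if_congr (by omega) rfl rfl
      · split_ifs <;> omega
  simp only [bestT, eval]
  exact (congrArg _ (min_eq_left h.types)).trans (key _ le_rfl).1

/-- `[…, j] ↦` whether `G.Near j` -/
def nearT : Term := tle (callWith₂ scoreT (callWith bestT (.var 8)) (.var 8)) (.var 4)

theorem Fits.eval_nearT (h : G.Fits B M) {j : ℕ} :
    nearT.eval B M (G.env ++ [j]) ≠ 0 ↔ G.Near j := by
  rw [nearT, eval_tle, eval_callWith₂ (G := G) (w := j) rfl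
    ((eval_callWith (G := G) (v := j) rfl rfl).trans h.eval_bestT) rfl,
    h.eval_scoreT (G.best_lt j)]
  rfl

/-- `[…, j] ↦ G.colType j` -/
def colTypeT : Term :=
  .ite (callWith nearT (.var 8)) (callWith bestT (.var 8))
    (call ![.var 3, .var 7, tcount 9 (.var 8) (tnot (callWith nearT (.var 9)))] digitT)

theorem Fits.eval_colTypeT (h : G.Fits B M) {j : ℕ} (hj : j ≤ B) :
    colTypeT.eval B M (G.env ++ [j]) = G.colType j := by
  have h₁ : (tcount 9 (.var 8) (tnot (callWith nearT (.var 9)))).eval B M (G.env ++ [j]) =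
      Nat.count (fun j => ¬ G.Near j) j := by
    refine eval_tcount (k := j) rfl rfl hj fun j' _ z => ?_
    rw [eval_tnot, eval_callWith (G := G) (v := j') rfl rfl, h.eval_nearT]
  rw [colTypeT, eval, eval_callWith (G := G) (v := j) rfl rfl,
    eval_callWith (G := G) (v := j) rfl rfl, h.eval_bestT,
    eval_call_three (x₁ := 2 ^ G.r) (x₂ := G.Z) rfl rfl h₁,
    eval_digitT h.types (Nat.two_pow_pos _) h.Z ((Nat.count_le _).trans hj), colType]
  exact if_congr h.eval_nearT rfl rfl

/-- `[…, u, i] ↦ G.mismatch u i` -/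
def mismatchT : Term :=
  tcount 10 (.var 1) (tne (call ![.var 2, .var 8, callWith colTypeT (.var 10)] entryT)
    (callWith₂ matrixT (.var 9) (.var 10)))

theorem Fits.eval_mismatchT (h : G.Fits B M) {u i : ℕ} (hu : u < 2 ^ G.r) :
    mismatchT.eval B M (G.env ++ [u, i]) = G.mismatch u i := by
  refine eval_tcount (k := G.n) rfl rfl h.n fun j hj z => ?_
  rw [eval_tne, eval_call_three (x₁ := G.r) (x₂ := u) (x₃ := G.colType j) rfl rfl
    ((eval_callWith (G := G) (v := j) rfl rfl).trans (h.eval_colTypeT (hj.le.trans h.n))),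
    eval_callWith₂ (G := G) (v := i) (w := j) rfl rfl rfl, h.eval_matrixT,
    eval_entryT h.two h.r (hu.le.trans h.types) ((G.colType_lt j).le.trans h.types)]

/-- `[…, i] ↦ G.rowCost i` -/
def rowCostT : Term :=
  .fold (.var 3) (.var 1) (.sub (.var 10)
    (.sub (.var 10) (callWith₂ mismatchT (.var 9) (.var 8))))

theorem Fits.eval_rowCostT (h : G.Fits B M) {i : ℕ} :
    rowCostT.eval B M (G.env ++ [i]) = G.rowCost i := by
  have key : ∀ N ≤ 2 ^ G.r, iterFrom (fun u y => (Term.sub (.var 10)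
        (.sub (.var 10) (callWith₂ mismatchT (.var 9) (.var 8)))).eval B M
          ((G.env ++ [i]) ++ [u, y])) G.n N =
        iterFrom (fun u y => min y (G.mismatch u i)) G.n N := by
    intro N hN
    induction N with
    | zero => rfl
    | succ N ih =>
      simp only [iterFrom, ih (by omega)]
      set y := iterFrom (fun u y => min y (G.mismatch u i)) G.n N
      rw [eval_sub, eval_sub, eval_callWith₂ (G := G) (v := N) (w := i) rfl rfl rfl,
        h.eval_mismatchT (by omega)]
      change y - (y - _) = _
      omega
  simp only [rowCostT, eval]
  exact (congrArg _ (min_eq_left h.types)).trans (key _ le_rfl)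

/-- `[…] ↦ G.total` -/
def totalT : Term := tsum 8 (.var 0) (callWith rowCostT (.var 8))

theorem Fits.eval_totalT (h : G.Fits B M) : totalT.eval B M G.env = G.total := by
  refine eval_tsum (k := G.m) rfl rfl h.m fun i _ z => ?_
  rw [eval_callWith (G := G) (v := i) rfl rfl, h.eval_rowCostT]

end BoolRank.Guess

/-! ### Counting and digits -/

namespace BoolRank

open RAM Finset

theorem count_eq_sum (P : ℕ → Prop) [DecidablePred P] (N : ℕ) :
    Nat.count P N = ∑ i ∈ range N, if P i then 1 else 0 := by
  rw [Nat.count_eq_card_filter_range, card_filter]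

theorem count_congr {P Q : ℕ → Prop} [DecidablePred P] [DecidablePred Q] {N : ℕ}
    (h : ∀ i < N, (P i ↔ Q i)) : Nat.count P N = Nat.count Q N := by
  rw [count_eq_sum, count_eq_sum]
  exact sum_congr rfl fun i hi => if_congr (h i (mem_range.1 hi)) rfl rfl

theorem sum_count_comm (P : ℕ → ℕ → Prop) [∀ i j, Decidable (P i j)] (m n : ℕ) :
    ∑ i ∈ range m, Nat.count (P i) n = ∑ j ∈ range n, Nat.count (fun i => P i j) m := by
  simp only [count_eq_sum]
  exact sum_comm

/-- Digits may be prescribed arbitrarily. -/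
theorem exists_digits {b : ℕ} (hb : 0 < b) (N : ℕ) (D : ℕ → ℕ) (hD : ∀ p < N, D p < b) :
    ∃ Y < b ^ N, ∀ p < N, digit b Y p = D p := by
  induction N with
  | zero => exact ⟨0, by simp, by simp⟩
  | succ N ih =>
    obtain ⟨Y, hY, h⟩ := ih fun p hp => hD p (by omega)
    refine ⟨Y + b ^ N * D N, ?_, fun p hp => ?_⟩
    · have := hD N (by omega)
      calc Y + b ^ N * D N < b ^ N * (D N + 1) := by rw [mul_add, mul_one]; omega
        _ ≤ b ^ N * b := Nat.mul_le_mul_left _ this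
        _ = b ^ (N + 1) := (pow_succ b N).symm
    · rcases Nat.lt_succ_iff_lt_or_eq.1 hp with hp | rfl
      · rw [← h p hp]
        obtain ⟨d, rfl⟩ := Nat.exists_eq_add_of_lt hp
        have : b ^ (p + d + 1) * D (p + d + 1) = b ^ p * (b * (b ^ d * D (p + d + 1))) := by ring
        rw [digit, digit, this, Nat.add_mul_div_left _ _ (pow_pos hb p), Nat.add_mul_mod_self_left]
      · rw [digit, Nat.add_mul_div_left _ _ (pow_pos hb p), Nat.div_eq_of_lt hY, zero_add,
          Nat.mod_eq_of_lt (hD p (by omega))]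

/-- A small set of numbers can be listed, with one further number as a filler. -/
theorem exists_listing (F : Finset ℕ) (s x : ℕ) (hF : F.card ≤ s) :
    ∃ f : ℕ → ℕ, (∀ q, f q ∈ F ∨ f q = x) ∧ ∀ y ∈ F, ∃ q < s, f q = y := by
  refine ⟨fun q => F.toList.getD q x, fun q => ?_, fun y hy => ?_⟩
  · rcases lt_or_ge q F.toList.length with h | h
    · left
      change F.toList.getD q x ∈ F
      rw [List.getD_eq_getElem _ _ h]
      exact mem_toList.1 (List.getElem_mem h)
    · right
      exact List.getD_eq_default _ _ h
  · obtain ⟨q, hq, rfl⟩ := List.getElem_of_mem (mem_toList.2 hy)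
    exact ⟨q, by rw [length_toList] at hq; omega, List.getD_eq_getElem _ _ hq⟩

theorem iterFrom_min_le {f : ℕ → ℕ} {x N u : ℕ} (hu : u < N) :
    iterFrom (fun u y => min y (f u)) x N ≤ f u := by
  induction N with
  | zero => omega
  | succ N ih =>
    rw [iterFrom]
    rcases Nat.lt_succ_iff_lt_or_eq.1 hu with hu | rfl
    · exact (min_le_left _ _).trans (ih hu)
    · exact min_le_right _ _

theorem iterFrom_min_eq (f : ℕ → ℕ) (x N : ℕ) :
    iterFrom (fun u y => min y (f u)) x N = x ∨
      ∃ u < N, iterFrom (fun u y => min y (f u)) x N = f u := by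
  induction N with
  | zero => exact Or.inl rfl
  | succ N ih =>
    rw [iterFrom]
    rcases min_choice (iterFrom (fun u y => min y (f u)) x N) (f N) with h | h
    · rw [h]
      exact ih.imp_right fun ⟨u, hu, e⟩ => ⟨u, by omega, e⟩
    · exact Or.inr ⟨N, by omega, h⟩

theorem iterFrom_argmin_le {f : ℕ → ℕ} {N T : ℕ} (hT : T < N) :
    f (iterFrom (fun T y => if f T < f y then T else y) 0 N) ≤ f T := by
  induction N with
  | zero => omega
  | succ N ih =>
    rw [iterFrom]
    rcases Nat.lt_succ_iff_lt_or_eq.1 hT with hT | rfl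
    · have := ih hT
      split_ifs <;> omega
    · split_ifs <;> omega

/-! ### Classes of equal lines -/

section Lines

variable {a : ℕ → ℕ → ℕ} {len cnt : ℕ}

theorem LineEq.symm {i i' : ℕ} (h : LineEq a len i i') : LineEq a len i' i :=
  fun j hj => (h j hj).symm

theorem LineEq.trans {i i' i'' : ℕ} (h : LineEq a len i i') (h' : LineEq a len i' i'') :
    LineEq a len i i'' :=
  fun j hj => (h j hj).trans (h' j hj)

theorem exists_inClass {i : ℕ} (hi : i < cnt) : ∃ ρ, InClass a len cnt ρ i := by
  have h : ∃ i₀, LineEq a len i₀ i := ⟨i, fun _ _ => rfl⟩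
  refine ⟨_, Nat.find h, (Nat.find_min' h fun _ _ => rfl).trans_lt hi, fun i' hi' he => ?_, rfl,
    Nat.find_spec h⟩
  exact Nat.find_min h hi' (he.trans (Nat.find_spec h))

theorem InClass.lineEq {ρ i i' : ℕ} (h : InClass a len cnt ρ i) (h' : InClass a len cnt ρ i') :
    LineEq a len i i' := by
  obtain ⟨i₀, _, hl, hc, he⟩ := h
  obtain ⟨i₁, _, hl', hc', he'⟩ := h'
  obtain rfl := Nat.count_injective hl hl' (hc.trans hc'.symm)
  exact he.symm.trans he'

theorem InClass.congr {ρ i i' : ℕ} (h : InClass a len cnt ρ i) (he : LineEq a len i i') :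
    InClass a len cnt ρ i' := by
  obtain ⟨i₀, h₀, hl, hc, he₀⟩ := h
  exact ⟨i₀, h₀, hl, hc, he₀.trans he⟩

theorem InClass.lt {ρ i : ℕ} (h : InClass a len cnt ρ i) :
    ρ < Nat.count (IsLeader a len) cnt := by
  obtain ⟨i₀, h₀, hl, rfl, -⟩ := h
  exact Nat.count_strict_mono hl h₀

/-- If the lines become copies of at most `R` lines after `k` changes, then there are at most
`R + k` different lines: every line is unchanged or contains a change. -/
theorem count_isLeader_le {c err : ℕ → ℕ} {R k : ℕ} (hc : ∀ i, c i < R)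
    (hk : ∑ i ∈ range cnt, err i ≤ k)
    (h : ∀ i < cnt, ∀ i' < cnt, err i = 0 → err i' = 0 → c i = c i' → LineEq a len i i') :
    Nat.count (IsLeader a len) cnt ≤ R + k := by
  rw [Nat.count_eq_card_filter_range,
    ← card_filter_add_card_filter_not (p := fun i => err i = 0)]
  refine add_le_add ?_ (le_trans ?_ hk)
  · rw [← card_range R]
    refine card_le_card_of_injOn c (fun i _ => mem_coe.2 (mem_range.2 (hc i))) ?_
    intro i hi i' hi' e
    simp only [coe_filter, mem_filter, mem_range, Set.mem_ofPred_eq] at hi hi'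
    rcases lt_trichotomy i i' with hlt | heq | hlt
    · exact absurd (h i hi.1.1 i' hi'.1.1 hi.2 hi'.2 e) (hi'.1.2 i hlt)
    · exact heq
    · exact absurd (h i' hi'.1.1 i hi.1.1 hi'.2 hi.2 e.symm) (hi.1.2 i' hlt)
  · rw [card_eq_sum_ones, filter_filter, sum_filter]
    refine sum_le_sum fun i _ => ?_
    split_ifs <;> omega

end Lines

/-! ### Correctness of the test of a guess -/

namespace Guess

variable (G : Guess)

theorem rowCost_le {u i : ℕ} (hu : u < 2 ^ G.r) : G.rowCost i ≤ G.mismatch u i :=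
  iterFrom_min_le (f := fun u => G.mismatch u i) hu

theorem exists_rowCost_eq (i : ℕ) : ∃ u, G.rowCost i = G.mismatch u i := by
  rcases iterFrom_min_eq (fun u => G.mismatch u i) G.n (2 ^ G.r) with h | ⟨u, _, h⟩
  · refine ⟨0, le_antisymm (G.rowCost_le (Nat.two_pow_pos _)) ?_⟩
    rw [rowCost, h]
    exact Nat.count_le _
  · exact ⟨u, h⟩

theorem score_best_le {T : ℕ} (hT : T < 2 ^ G.r) (j : ℕ) :
    G.score (G.best j) j ≤ G.score T j :=
  iterFrom_argmin_le (f := fun T => G.score T j) hT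

/-- The number of entries of column `j` that differ from those of a column of type `T`, if the
rows have the types `u`. -/
def trueDist (u : ℕ → ℕ) (T j : ℕ) : ℕ :=
  Nat.count (fun i => entry G.r (u i) T ≠ G.a i j) G.m

/-- For row types `u` and column types `v`, the type `T` is guessable if some column of this type
is at distance at most `s` from the center. -/
def Guessable (u v : ℕ → ℕ) (T : ℕ) : Prop := ∃ j < G.n, v j = T ∧ G.trueDist u T j ≤ G.s

/-- The guess has the true centers of the guessable types, and no other centers. -/
structure Faithful (u v : ℕ → ℕ) : Prop where
  live : ∀ T < 2 ^ G.r, (G.Live T ↔ G.Guessable u v T)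
  center : ∀ T < 2 ^ G.r, G.Guessable u v T → ∀ i < G.m, G.center T i = entry G.r (u i) T

variable {G} {u v : ℕ → ℕ}

theorem Faithful.score_eq (h : G.Faithful u v) {T : ℕ} (hT : T < 2 ^ G.r)
    (hg : G.Guessable u v T) (j : ℕ) : G.score T j = G.trueDist u T j := by
  rw [score, if_pos ((h.live T hT).2 hg), dist, trueDist]
  exact count_congr fun i hi => by rw [h.center T hT hg i hi]

/-- A near column is not farther from its nearest guessed center than from its true one: if the
true center was not guessed, then it is at distance more than `s`. -/
theorem Faithful.trueDist_best_le (h : G.Faithful u v) (hv : ∀ j, v j < 2 ^ G.r) {j : ℕ}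
    (hj : j < G.n) (hn : G.Near j) : G.trueDist u (G.best j) j ≤ G.trueDist u (v j) j := by
  have hlive : G.Live (G.best j) := by
    by_contra hl
    rw [Near, score, if_neg hl] at hn
    omega
  rw [← h.score_eq (G.best_lt j) ((h.live _ (G.best_lt j)).1 hlive)]
  by_cases hg : G.Guessable u v (v j)
  · rw [← h.score_eq (hv j) hg]
    exact G.score_best_le (hv j) j
  · refine hn.trans (le_of_lt ?_)
    by_contra hd
    exact hg ⟨j, hj, rfl, not_lt.1 hd⟩

theorem Faithful.lt_trueDist (h : G.Faithful u v) (hv : ∀ j, v j < 2 ^ G.r) {j : ℕ}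
    (hj : j < G.n) (hn : ¬ G.Near j) : G.s < G.trueDist u (v j) j := by
  by_contra hd
  have hg : G.Guessable u v (v j) := ⟨j, hj, rfl, not_lt.1 hd⟩
  refine hn ((G.score_best_le (hv j) j).trans ?_)
  rw [h.score_eq (hv j) hg]
  exact not_lt.1 hd

/-- Since a far column costs more than `s` changes, there are few of them. -/
theorem Faithful.count_far_le (h : G.Faithful u v) (hv : ∀ j, v j < 2 ^ G.r) {k K : ℕ}
    (hk : ∑ j ∈ range G.n, G.trueDist u (v j) j ≤ k) (hK : k ≤ G.s * K) :
    Nat.count (fun j => ¬ G.Near j) G.n ≤ K := by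
  have : (G.s + 1) * Nat.count (fun j => ¬ G.Near j) G.n ≤ k := by
    refine le_trans ?_ hk
    rw [count_eq_sum, mul_sum]
    refine sum_le_sum fun j hj => ?_
    split_ifs with hn
    · simp
    · have := h.lt_trueDist hv (mem_range.1 hj) hn
      omega
  by_contra hlt
  nlinarith

/-- A faithful guess that gives the far columns their true types passes the test. -/
theorem Faithful.total_le (h : G.Faithful u v) (hu : ∀ i, u i < 2 ^ G.r)
    (hv : ∀ j, v j < 2 ^ G.r)
    (hZ : ∀ j < G.n, ¬ G.Near j →
      digit (2 ^ G.r) G.Z (Nat.count (fun j => ¬ G.Near j) j) = v j) :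
    G.total ≤ ∑ j ∈ range G.n, G.trueDist u (v j) j := by
  calc G.total ≤ ∑ i ∈ range G.m, G.mismatch (u i) i := sum_le_sum fun i _ => G.rowCost_le (hu i)
    _ = ∑ j ∈ range G.n, G.trueDist u (G.colType j) j :=
      sum_count_comm (fun i j => entry G.r (u i) (G.colType j) ≠ G.a i j) G.m G.n
    _ ≤ _ := sum_le_sum fun j hj => ?_
  rw [mem_range] at hj
  unfold colType
  split_ifs with hn
  · exact h.trueDist_best_le hv hj hn
  · rw [hZ j hj hn]

end Guess

section Completeness

variable {a : ℕ → ℕ → ℕ} {m n r s k : ℕ} {u v : ℕ → ℕ}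

/-- The rows can be given types that depend on the contents of the row only. -/
theorem exists_row_types (a : ℕ → ℕ → ℕ) (m n r : ℕ) (u v : ℕ → ℕ) (hu : ∀ i, u i < 2 ^ r) :
    ∃ u' : ℕ → ℕ, (∀ i, u' i < 2 ^ r) ∧ (∀ i i', LineEq a n i i' → u' i = u' i') ∧
      ∑ i ∈ range m, Nat.count (fun j => entry r (u' i) (v j) ≠ a i j) n ≤
        ∑ i ∈ range m, Nat.count (fun j => entry r (u i) (v j) ≠ a i j) n := by
  have h : ∀ f : ℕ → ℕ, ∃ w < 2 ^ r, ∀ w' < 2 ^ r, f w ≤ f w' := by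
    intro f
    obtain ⟨w, hw, hmin⟩ := exists_min_image (range (2 ^ r)) f ⟨0, by simp⟩
    exact ⟨w, mem_range.1 hw, fun w' hw' => hmin w' (mem_range.2 hw')⟩
  choose pick hlt hmin using h
  refine ⟨fun i => pick fun w => Nat.count (fun j => entry r w (v j) ≠ a i j) n,
    fun i => hlt _, fun i i' he => ?_, sum_le_sum fun i _ =>
      hmin (fun w => Nat.count (fun j => entry r w (v j) ≠ a i j) n) (u i) (hu i)⟩
  refine congrArg pick (funext fun w => count_congr fun j hj => ?_)
  rw [he j hj]

theorem entry_le_one (r u v : ℕ) : entry r u v ≤ 1 := by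
  unfold entry; split_ifs <;> omega

/-- If there is a solution with row types `u` and column types `v`, then some number encodes the
true centers of all guessable types. -/
theorem exists_faithful (ha : ∀ i j, a i j ≤ 1) (hu : ∀ i, u i < 2 ^ r)
    (hv : ∀ j, v j < 2 ^ r) (hrow : ∀ i i', LineEq a n i i' → u i = u i')
    (hk : ∑ i ∈ range m, Nat.count (fun j => entry r (u i) (v j) ≠ a i j) n ≤ k) :
    ∃ Y < (2 ^ r + k + 1) ^ (2 ^ r * (s + 1)),
      ∀ Z, (Guess.mk a m n r s (2 ^ r + k + 1) Y Z).Faithful u v := by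
  classical
  have hrows : Nat.count (IsLeader a n) m ≤ 2 ^ r + k := by
    refine count_isLeader_le hu hk fun i _ i' _ h h' e j hj => ?_
    rw [Nat.count_iff_forall_not] at h h'
    rw [← not_not.1 (h j hj), ← not_not.1 (h' j hj), e]
  have hcols : Nat.count (IsLeader (fun j i => a i j) m) n ≤ 2 ^ r + k := by
    refine count_isLeader_le hv
      (err := fun j => Nat.count (fun i => entry r (u i) (v j) ≠ a i j) m)
      ((sum_count_comm (fun i j => entry r (u i) (v j) ≠ a i j) m n).symm.trans_le hk)
      fun j _ j' _ h h' e i hi => ?_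
    rw [Nat.count_iff_forall_not] at h h'
    rw [← not_not.1 (h i hi), ← not_not.1 (h' i hi), e]
  let G₀ : Guess := ⟨a, m, n, r, s, 2 ^ r + k + 1, 0, 0⟩
  choose! cls hcls using fun i (hi : i < m) => exists_inClass (a := a) (len := n) hi
  -- the digits of one type: the class of the column, and the classes of the rows to be changed
  have key : ∀ T, ∃ (c : ℕ) (f : ℕ → ℕ), c < 2 ^ r + k + 1 ∧ (∀ q, f q < 2 ^ r + k + 1) ∧
      (¬ G₀.Guessable u v T → c = 2 ^ r + k) ∧
      (G₀.Guessable u v T → ∃ j₀ < n, InClass (fun j i => a i j) m n c j₀ ∧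
        ∀ i < m, ((∃ q < s, InClass a n m (f q) i) ↔ entry r (u i) T ≠ a i j₀)) := by
    intro T
    by_cases hg : G₀.Guessable u v T
    · obtain ⟨j₀, hj₀, hvj, hd⟩ := hg
      change j₀ < n at hj₀
      obtain ⟨c, hc⟩ := exists_inClass (a := fun j i => a i j) (len := m) hj₀
      obtain ⟨f, hf, hf'⟩ := exists_listing
        (((range m).filter fun i => entry r (u i) T ≠ a i j₀).image cls) s (2 ^ r + k) (by
          refine card_image_le.trans ?_
          rw [← Nat.count_eq_card_filter_range]
          exact hd)
      have hF : ∀ q, f q = 2 ^ r + k ∨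
          ∃ i < m, entry r (u i) T ≠ a i j₀ ∧ f q = cls i := by
        intro q
        rcases hf q with h | h
        · obtain ⟨i, hi, e⟩ := mem_image.1 h
          rw [mem_filter, mem_range] at hi
          exact Or.inr ⟨i, hi.1, hi.2, e.symm⟩
        · exact Or.inl h
      refine ⟨c, f, by have := hc.lt; omega, fun q => ?_, fun h => absurd ⟨j₀, hj₀, hvj, hd⟩ h,
        fun _ => ⟨j₀, hj₀, hc, fun i hi => ⟨?_, fun h => ?_⟩⟩⟩
      · rcases hF q with h | ⟨i, hi, -, h⟩
        · omega
        · have := (hcls i hi).lt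
          omega
      · rintro ⟨q, -, hq⟩
        rcases hF q with h | ⟨i', hi', hne, h⟩
        · have := hq.lt
          omega
        · rw [h] at hq
          have he := (hcls i' hi').lineEq hq
          rwa [← hrow i' i he, ← he j₀ hj₀]
      · obtain ⟨q, hq, e⟩ := hf' (cls i) (mem_image_of_mem _ (mem_filter.2 ⟨mem_range.2 hi, h⟩))
        exact ⟨q, hq, e ▸ hcls i hi⟩
    · exact ⟨2 ^ r + k, fun _ => 0, by omega, fun _ => Nat.succ_pos _, fun _ => rfl,
        fun h => absurd h hg⟩
  choose c f hc hf hno hyes using key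
  obtain ⟨Y, hY, hdig⟩ := exists_digits (b := 2 ^ r + k + 1) (by omega) (2 ^ r * (s + 1))
    (fun p => if p % (s + 1) = 0 then c (p / (s + 1)) else f (p / (s + 1)) (p % (s + 1) - 1))
    (fun p _ => by split_ifs; exacts [hc _, hf _ _])
  have hdc : ∀ T < 2 ^ r, digit (2 ^ r + k + 1) Y (T * (s + 1)) = c T := by
    intro T hT
    rw [hdig _ (Nat.mul_lt_mul_of_pos_right hT (Nat.succ_pos s)), if_pos (Nat.mul_mod_left _ _),
      Nat.mul_div_cancel _ (Nat.succ_pos s)]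
  have hdf : ∀ T < 2 ^ r, ∀ q < s, digit (2 ^ r + k + 1) Y (T * (s + 1) + 1 + q) = f T q := by
    intro T hT q hq
    have h₁ : (T * (s + 1) + 1 + q) % (s + 1) = q + 1 := by
      rw [add_assoc, Nat.mul_add_mod', Nat.mod_eq_of_lt (by omega), add_comm]
    have h₂ : (T * (s + 1) + 1 + q) / (s + 1) = T := by
      rw [add_assoc, mul_comm, Nat.mul_add_div (Nat.succ_pos s), Nat.div_eq_of_lt (by omega),
        add_zero]
    rw [hdig, h₁, h₂, if_neg (Nat.succ_ne_zero q), Nat.add_sub_cancel]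
    have : (T + 1) * (s + 1) ≤ 2 ^ r * (s + 1) := Nat.mul_le_mul_right _ hT
    nlinarith
  refine ⟨Y, hY, fun Z => ?_⟩
  set G : Guess := ⟨a, m, n, r, s, 2 ^ r + k + 1, Y, Z⟩ with hG
  have hch : ∀ T < 2 ^ r, ∀ j, G.Chosen T j ↔ InClass (fun j i => a i j) m n (c T) j := by
    intro T hT j
    rw [← hdc T hT]
    rfl
  have hfl : ∀ T < 2 ^ r, ∀ i, G.Flip T i ↔ ∃ q < s, InClass a n m (f T q) i := by
    intro T hT i
    refine exists_congr fun q => and_congr_right fun hq => ?_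
    rw [← hdf T hT q hq]
  constructor
  · intro T hT
    constructor
    · rintro ⟨j, -, hj⟩
      by_contra hg
      have := ((hch T hT j).1 hj).lt
      have := hno T hg
      omega
    · intro hg
      obtain ⟨j₀, hj₀, hj, -⟩ := hyes T hg
      exact ⟨j₀, hj₀, (hch T hT j₀).2 hj⟩
  · intro T hT hg i hi
    obtain ⟨j₀, hj₀, hj, hflip⟩ := hyes T hg
    have hval : G.Val T i ↔ a i j₀ ≠ 0 := by
      constructor
      · rintro ⟨j, -, hj', hne⟩
        have he : a i j = a i j₀ := ((hch T hT j).1 hj').lineEq hj i hi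
        change a i j ≠ 0 at hne
        rwa [← he]
      · exact fun hne => ⟨j₀, hj₀, (hch T hT j₀).2 hj, hne⟩
    rw [Guess.center]
    simp only [hval, (hfl T hT i).trans (hflip i hi)]
    have h₁ := ha i j₀
    have h₂ := entry_le_one r (u i) T
    change _ = entry r (u i) T
    split_ifs <;> omega

/-- If the matrix has a good approximation, then some guess passes the test. -/
theorem exists_guess (ha : ∀ i j, a i j ≤ 1) (hu : ∀ i, u i < 2 ^ r) (hv : ∀ j, v j < 2 ^ r)
    (hk : ∑ i ∈ range m, Nat.count (fun j => entry r (u i) (v j) ≠ a i j) n ≤ k)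
    {K : ℕ} (hK : k ≤ s * K) :
    ∃ Y < (2 ^ r + k + 1) ^ (2 ^ r * (s + 1)), ∃ Z < (2 ^ r) ^ K,
      (Guess.mk a m n r s (2 ^ r + k + 1) Y Z).total ≤ k := by
  obtain ⟨u', hu', hrow, hle⟩ := exists_row_types a m n r u v hu
  have hk' := hle.trans hk
  obtain ⟨Y, hY, hf⟩ := exists_faithful (s := s) ha hu' hv hrow hk'
  let G₀ : Guess := ⟨a, m, n, r, s, 2 ^ r + k + 1, Y, 0⟩
  have hsum : ∑ j ∈ range n, G₀.trueDist u' (v j) j ≤ k :=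
    (sum_count_comm (fun i j => entry r (u' i) (v j) ≠ a i j) m n).symm.trans_le hk'
  obtain ⟨Z, hZ, hdig⟩ := exists_digits (Nat.two_pow_pos r) K
    (fun p => v (Nat.nth (fun j => ¬ G₀.Near j) p)) fun p _ => hv _
  refine ⟨Y, hY, Z, hZ, ((hf Z).total_le hu' hv fun j hj hn => ?_).trans hsum⟩
  have hn : ¬ G₀.Near j := hn
  refine (hdig (Nat.count (fun j => ¬ G₀.Near j) j) ?_).trans ?_
  · exact (Nat.count_strict_mono hn hj).trans_le ((hf 0).count_far_le hv hsum hK)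
  · rw [Nat.nth_count hn]

end Completeness

/-! ### Guesses and yes-instances -/

namespace Instance

variable (x : Instance)

/-- The contents of the matrix, read from the memory. -/
def matrix (i j : ℕ) : ℕ := x.input.mem (x.n * i + j)

theorem matrix_eq (i : Fin x.m) (j : Fin x.n) : x.matrix i j = (x.A i j).toNat := by
  have h₁ : (x.n * (i : ℕ) + j) / x.n = i := by
    rw [Nat.mul_add_div x.n_pos, Nat.div_eq_of_lt j.2, add_zero]
  have h₂ : (x.n * (i : ℕ) + j) % x.n = j := by
    rw [Nat.mul_add_mod, Nat.mod_eq_of_lt j.2]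
  simp [matrix, input, h₁, h₂]

theorem matrix_le_one (i j : ℕ) : x.matrix i j ≤ 1 := by
  simp only [matrix, input]
  split_ifs
  · exact Bool.toNat_le _
  · omega

theorem matrixHammingDist_eq {B : Matrix (Fin x.m) (Fin x.n) Bool} {b : ℕ → ℕ → ℕ}
    (hb : ∀ (i : Fin x.m) (j : Fin x.n), b i j = (B i j).toNat) :
    matrixHammingDist x.A B =
      ∑ i ∈ range x.m, Nat.count (fun j => b i j ≠ x.matrix i j) x.n := by
  rw [sum_count_comm (fun i j => b i j ≠ x.matrix i j), matrixHammingDist,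
    ← Fin.sum_univ_eq_sum_range]
  refine sum_congr rfl fun j _ => ?_
  rw [hammingDist, count_eq_sum, card_filter, ← Fin.sum_univ_eq_sum_range]
  refine sum_congr rfl fun i _ => if_congr ?_ rfl rfl
  rw [hb, matrix_eq, ne_comm]
  cases x.A i j <;> cases B i j <;> simp

/-- Soundness: a guess that passes the test provides an approximation, whether or not it is the
encoding of true centers. -/
theorem isYes_of_total_le {s b Y Z : ℕ}
    (h : (Guess.mk x.matrix x.m x.n x.r s b Y Z).total ≤ x.k) : x.IsYes := by
  set G : Guess := ⟨x.matrix, x.m, x.n, x.r, s, b, Y, Z⟩ with hG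
  choose u hu using G.exists_rowCost_eq
  let U : Matrix (Fin x.m) (Fin x.r) Bool := fun i l => decide (digit 2 (u i) l ≠ 0)
  let V : Matrix (Fin x.r) (Fin x.n) Bool := fun l j => decide (digit 2 (G.colType j) l ≠ 0)
  refine ⟨boolMul U V, Nat.sInf_le ⟨U, V, rfl⟩, le_of_eq_of_le ?_ h⟩
  rw [x.matrixHammingDist_eq (b := fun i j => entry x.r (u i) (G.colType j))]
  · exact sum_congr rfl fun i _ => (hu i).symm
  · intro i j
    have : (∃ l < x.r, digit 2 (u i) l ≠ 0 ∧ digit 2 (G.colType j) l ≠ 0) ↔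
        ∃ l, U i l = true ∧ V l j = true := by
      simp only [U, V, decide_eq_true_eq]
      exact ⟨fun ⟨l, hl, h⟩ => ⟨⟨l, hl⟩, h⟩, fun ⟨l, h⟩ => ⟨l, l.2, h⟩⟩
    simp only [entry, boolMul, this]
    split_ifs with h' <;> simp [h']

/-- A solution of smaller Boolean rank than `r` also has types among the subsets of
`{0, …, r - 1}`. -/
theorem IsYes.exists_types {x : Instance} (h : x.IsYes) :
    ∃ u v : ℕ → ℕ, (∀ i, u i < 2 ^ x.r) ∧ (∀ j, v j < 2 ^ x.r) ∧
      ∑ i ∈ range x.m, Nat.count (fun j => entry x.r (u i) (v j) ≠ x.matrix i j) x.n ≤ x.k := by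
  obtain ⟨B, hr, hk⟩ := h
  obtain ⟨U, V, hB⟩ : ∃ (U : Matrix (Fin x.m) (Fin (booleanRank B)) Bool)
      (V : Matrix (Fin (booleanRank B)) (Fin x.n) Bool), B = boolMul U V :=
    Nat.sInf_mem (exists_boolMul B)
  have hcode : ∀ S : ℕ → Prop, ∃ w < 2 ^ x.r, ∀ l < x.r, (digit 2 w l ≠ 0 ↔ S l) := by
    classical
    intro S
    obtain ⟨w, hw, hd⟩ := exists_digits two_pos x.r (fun l => if S l then 1 else 0)
      fun l _ => by split_ifs <;> omega
    refine ⟨w, hw, fun l hl => ?_⟩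
    rw [hd l hl]
    split_ifs with h <;> simp [h]
  choose code hlt hdig using hcode
  refine ⟨fun i => code fun l => ∃ (hi : i < x.m) (hl : l < booleanRank B),
      U ⟨i, hi⟩ ⟨l, hl⟩ = true,
    fun j => code fun l => ∃ (hj : j < x.n) (hl : l < booleanRank B),
      V ⟨l, hl⟩ ⟨j, hj⟩ = true,
    fun i => hlt _, fun j => hlt _, le_of_eq_of_le (Eq.symm ?_) hk⟩
  refine x.matrixHammingDist_eq fun i j => ?_
  rw [entry, congrFun (congrFun hB i) j, boolMul]
  have : (∃ l < x.r,
      digit 2 (code fun l => ∃ (hi : (i : ℕ) < x.m) (hl : l < booleanRank B),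
        U ⟨i, hi⟩ ⟨l, hl⟩ = true) l ≠ 0 ∧
      digit 2 (code fun l => ∃ (hj : (j : ℕ) < x.n) (hl : l < booleanRank B),
        V ⟨l, hl⟩ ⟨j, hj⟩ = true) l ≠ 0) ↔ ∃ l, U i l = true ∧ V l j = true := by
    constructor
    · rintro ⟨l, hl, h₁, h₂⟩
      obtain ⟨_, hl', h₁⟩ := (hdig _ l hl).1 h₁
      obtain ⟨_, _, h₂⟩ := (hdig _ l hl).1 h₂
      exact ⟨⟨l, hl'⟩, h₁, h₂⟩
    · rintro ⟨l, h₁, h₂⟩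
      have hl : (l : ℕ) < x.r := l.2.trans_le hr
      exact ⟨l, hl, (hdig _ l hl).2 ⟨i.2, l.2, h₁⟩, (hdig _ l hl).2 ⟨j.2, l.2, h₂⟩⟩
  simp only [this]
  split_ifs with h' <;> simp [h']

/-- Yes-instances are the instances for which some guess passes the test. -/
theorem isYes_iff {s K : ℕ} (hK : x.k ≤ s * K) :
    x.IsYes ↔ ∃ Y < (2 ^ x.r + x.k + 1) ^ (2 ^ x.r * (s + 1)), ∃ Z < (2 ^ x.r) ^ K,
      (Guess.mk x.matrix x.m x.n x.r s (2 ^ x.r + x.k + 1) Y Z).total ≤ x.k := by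
  constructor
  · intro h
    obtain ⟨u, v, hu, hv, hk⟩ := h.exists_types
    exact exists_guess x.matrix_le_one hu hv hk hK
  · rintro ⟨Y, -, Z, -, h⟩
    exact x.isYes_of_total_le h

end Instance

end BoolRank

/-! ### Programs that extend an environment -/

namespace RAM

/-- The memory is `M`, and the first registers contain the numbers in `e`. -/
def Holds (M : ℕ → ℕ) (e : List ℕ) (s : State) : Prop :=
  s.mem = M ∧ ∀ i < e.length, s.reg i = e.getD i 0

/-- The program `p` turns an environment `e` into `e'`, within time `T`. -/
def Runs (M : ℕ → ℕ) (p : Program) (e e' : List ℕ) (T : ℕ) : Prop :=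
  ∀ s, Holds M e s → ∃ s' t, Exec p s s' t ∧ Holds M e' s' ∧ t ≤ T

variable {M : ℕ → ℕ} {e e' e'' : List ℕ}

theorem Runs.seq {p q : Program} {T T' : ℕ} (hp : Runs M p e e' T) (hq : Runs M q e' e'' T') :
    Runs M (.seq p q) e e'' (T + T') := by
  intro s hs
  obtain ⟨s₁, t₁, h₁, hs₁, ht₁⟩ := hp s hs
  obtain ⟨s₂, t₂, h₂, hs₂, ht₂⟩ := hq s₁ hs₁
  exact ⟨s₂, t₁ + t₂, h₁.seq h₂, hs₂, by omega⟩

theorem runs_assign {i v : ℕ} {x : Expr} (hv : ∀ s, Holds M e s → x.eval s = v) :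
    Runs M (.assign i x) e (e.set i v) (x.cost + 1) := by
  refine fun s hs => ⟨_, _, Exec.assign s i x, ⟨hs.1, fun j hj => ?_⟩, le_rfl⟩
  rw [List.length_set] at hj
  by_cases h : j = i
  · subst h
    simp [hv s hs, hj, List.getD_eq_getElem?_getD]
  · simp [Function.update_of_ne h, hs.2 j hj, List.getD_eq_getElem?_getD,
      List.getElem?_set_ne (Ne.symm h)]

theorem runs_compile {t : Term} {B v : ℕ} (he : 4 < e.length) (hB : e.getD 4 0 = B)
    (hv : t.eval B M e = v) :
    Runs M (t.compile (List.range e.length) e.length) e (e ++ [v]) (t.cost B) := by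
  intro s hs
  obtain ⟨s', τ, hx, hτ, hm, hr, hres⟩ := t.compile_yields (List.range e.length) e.length s he
    fun x hx => List.mem_range.1 hx
  have hmap : (List.range e.length).map s.reg = e := by
    refine List.ext_getElem (by simp) fun i h₁ h₂ => ?_
    rw [List.getElem_map, List.getElem_range, hs.2 i h₂, List.getD_eq_getElem _ _ h₂]
  rw [hs.2 4 he, hB, hs.1, hmap, hv] at hres
  rw [hs.2 4 he, hB] at hτ
  refine ⟨s', τ, hx, ⟨hm.trans hs.1, fun i hi => ?_⟩, hτ⟩
  rw [List.length_append, List.length_singleton] at hi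
  rcases Nat.lt_succ_iff_lt_or_eq.1 hi with hi | rfl
  · rw [hr i hi, hs.2 i hi, List.getD_append _ _ _ _ hi]
  · rw [hres, List.getD_append_right _ _ _ _ le_rfl, Nat.sub_self]
    rfl

end RAM

/-! ### The parameters of the algorithm -/

namespace BoolRank

/-- The number of binary digits of `k + 1`. -/
def bits (k : ℕ) : ℕ := Nat.log 2 (k + 1) + 1

/-- The distance up to which a column counts as near, about the square root of `k / log k`. -/
def radius (k : ℕ) : ℕ := Nat.sqrt ((k - 1) / bits k) + 1

/-- A bound for the number of far columns, about the square root of `k * log k`. -/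
def farBound (k : ℕ) : ℕ := radius k * bits k

theorem bits_pos (k : ℕ) : 0 < bits k := Nat.succ_pos _

theorem bits_le (k : ℕ) : bits k ≤ k + 1 := Nat.log_lt_self 2 (Nat.succ_ne_zero k)

theorem lt_two_pow_bits (k : ℕ) : k + 1 < 2 ^ bits k := Nat.lt_pow_succ_log_self one_lt_two _

theorem radius_le (k : ℕ) : radius k ≤ k + 1 :=
  Nat.succ_le_succ ((Nat.sqrt_le_self _).trans ((Nat.div_le_self _ _).trans (Nat.sub_le _ _)))

/-- More than `farBound k` far columns, at more than `radius k` changes each, exceed the budget. -/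
theorem le_radius_mul_farBound (k : ℕ) : k ≤ radius k * farBound k := by
  have h : (k - 1) / bits k < radius k ^ 2 := Nat.lt_succ_sqrt' _
  rw [Nat.div_lt_iff_lt_mul (bits_pos k)] at h
  have : radius k * farBound k = radius k ^ 2 * bits k := by rw [farBound]; ring
  omega

/-- Writing `q` for `radius k - 1` and `l` for `bits k`, both `q ^ 2 * l` and `l` are at most `k`, and
`farBound k ^ 2 = (q * l + l) ^ 2`. -/
theorem sq_farBound_le {k : ℕ} (hk : 2 ≤ k) : farBound k ^ 2 ≤ 4 * (k * bits k) := by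
  have h₁ : Nat.sqrt ((k - 1) / bits k) ^ 2 * bits k ≤ k :=
    (Nat.mul_le_mul_right _ (Nat.sqrt_le' _)).trans
      ((Nat.div_mul_le_self _ _).trans (Nat.sub_le _ _))
  have h₂ : bits k ≤ k := by
    refine Nat.log_lt_of_lt_pow (Nat.succ_ne_zero k) ?_
    clear h₁
    induction k, hk using Nat.le_induction with
    | base => norm_num
    | succ k hk ih => rw [pow_succ]; omega
  rw [farBound, radius]
  set q := Nat.sqrt ((k - 1) / bits k)
  set l := bits k
  have h₃ : q ^ 2 * l * l ≤ k * l := Nat.mul_le_mul_right _ h₁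
  have h₄ : l * l ≤ k * l := Nat.mul_le_mul_right _ h₂
  have h₅ : 2 * q ≤ q ^ 2 + 1 := by nlinarith [sq_nonneg ((q : ℤ) - 1), two_mul_le_add_sq q 1]
  have h₆ : 2 * q * (l * l) ≤ (q ^ 2 + 1) * (l * l) := Nat.mul_le_mul_right _ h₅
  nlinarith

theorem bits_le_logb {k : ℕ} (hk : 2 ≤ k) : (bits k : ℝ) ≤ 3 * Real.logb 2 k := by
  have hk' : (2 : ℝ) ≤ k := by exact_mod_cast hk
  have h₁ : (Nat.log 2 (k + 1) : ℝ) ≤ Real.logb 2 ((k + 1 : ℕ) : ℝ) := by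
    have := Real.natLog_le_logb (k + 1) 2
    exact_mod_cast this
  have h₂ : Real.logb 2 ((k + 1 : ℕ) : ℝ) ≤ Real.logb 2 ((k : ℝ) ^ 2) := by
    refine Real.logb_le_logb_of_le one_lt_two (by positivity) ?_
    push_cast
    nlinarith
  rw [Real.logb_pow] at h₂
  have h₃ : 1 ≤ Real.logb 2 (k : ℝ) := by
    rw [Real.le_logb_iff_rpow_le one_lt_two (by positivity), Real.rpow_one]
    exact hk'
  rw [bits]
  push_cast at *
  linarith

theorem farBound_le (k : ℕ) :
    (farBound k : ℝ) ≤ 4 * max 1 (Real.sqrt ((k : ℝ) * Real.logb 2 (k : ℝ))) := by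
  rcases lt_or_ge k 2 with hk | hk
  · have h₁ : farBound k ≤ 4 := by
      have h₂ : bits k ≤ 2 := (bits_le k).trans (by omega)
      have h₃ : radius k ≤ 2 := (radius_le k).trans (by omega)
      exact Nat.mul_le_mul h₃ h₂
    have h₂ : (farBound k : ℝ) ≤ 4 := by exact_mod_cast h₁
    have := le_max_left 1 (Real.sqrt ((k : ℝ) * Real.logb 2 (k : ℝ)))
    linarith
  · have h₁ : (farBound k : ℝ) ^ 2 ≤ 4 * (k * bits k) := by exact_mod_cast sq_farBound_le hk
    have h₂ := bits_le_logb hk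
    have h₃ : 0 ≤ Real.logb 2 (k : ℝ) := Real.logb_nonneg one_lt_two (by norm_cast; omega)
    have h₄ : (farBound k : ℝ) ≤ 4 * Real.sqrt ((k : ℝ) * Real.logb 2 (k : ℝ)) := by
      refine le_of_sq_le_sq ?_ (by positivity)
      rw [mul_pow, Real.sq_sqrt (by positivity)]
      have : (k : ℝ) * bits k ≤ k * (3 * Real.logb 2 k) :=
        mul_le_mul_of_nonneg_left h₂ (Nat.cast_nonneg k)
      have := mul_nonneg (Nat.cast_nonneg (α := ℝ) k) h₃
      linarith
    exact h₄.trans (mul_le_mul_of_nonneg_left (le_max_right _ _) (by norm_num))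

/-- The final cut-off for iterations. -/
def cutoff (m n r k : ℕ) : ℕ :=
  m + n + r + k + 2 + 2 ^ r + 2 ^ r * (radius k + 1) + farBound k +
    (2 ^ r + k + 1) ^ (2 ^ r * (radius k + 1)) + (2 ^ r) ^ farBound k

/-- The cut-off is bounded by the product that is asked for. The base `2 ^ r + k + 1` of the digits
has at most `r + bits k` binary digits, which is at most `2 * r * bits k`. -/
theorem cutoff_le {m n r k : ℕ} (hm : 0 < m) (hn : 0 < n) (hr : 0 < r) :
    cutoff m n r k + 1 ≤ 2 ^ (8 * (r * 2 ^ r * farBound k)) * (n * m) := by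
  have hs : 0 < radius k := Nat.succ_pos _
  have hl : 0 < bits k := bits_pos k
  have hk := lt_two_pow_bits k
  have hrR : r < 2 ^ r := Nat.lt_two_pow_self
  have hb : 2 ^ r + k + 1 ≤ 2 ^ (r + bits k) := by
    have h₁ : 2 ≤ 2 ^ r := Nat.le_self_pow hr.ne' 2
    have h₂ : 2 ≤ 2 ^ bits k := Nat.le_self_pow hl.ne' 2
    rw [pow_add]
    nlinarith
  rw [cutoff, farBound]
  set s := radius k
  set l := bits k
  set R := 2 ^ r with hR
  set E := r * R * (s * l) with hE
  have hR0 : 0 < R := by omega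
  have hE0 : 0 < E := by positivity
  have up : ∀ {x}, x ≤ 4 * E → 2 ^ x ≤ 2 ^ (4 * E) := fun h => Nat.pow_le_pow_right two_pos h
  have hlE : l ≤ E := by
    rw [hE, ← mul_assoc]; exact Nat.le_mul_of_pos_left _ (by positivity)
  have hrE : r ≤ E := by
    rw [hE, mul_assoc]; exact Nat.le_mul_of_pos_right _ (by positivity)
  have hKE : s * l ≤ E := Nat.le_mul_of_pos_left _ (by positivity)
  have hDE : R * (s + 1) ≤ 2 * E := by
    calc R * (s + 1) ≤ R * (2 * s) := Nat.mul_le_mul_left _ (by omega)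
      _ ≤ (r * l) * (R * (2 * s)) := Nat.le_mul_of_pos_left _ (by positivity)
      _ = 2 * E := by rw [hE]; ring
  have hE4 : 2 * E ≤ 2 ^ (4 * E) :=
    (show 2 * E ≤ 4 * E by omega).trans Nat.lt_two_pow_self.le
  have hNa : (R + k + 1) ^ (R * (s + 1)) ≤ 2 ^ (4 * E) := by
    calc (R + k + 1) ^ (R * (s + 1)) ≤ (2 ^ (r + l)) ^ (R * (s + 1)) := Nat.pow_le_pow_left hb _
      _ = 2 ^ ((r + l) * (R * (s + 1))) := (pow_mul _ _ _).symm
      _ ≤ 2 ^ (4 * E) := up ?_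
    have h₁ : r + l ≤ 2 * (r * l) := by nlinarith
    calc (r + l) * (R * (s + 1)) ≤ (2 * (r * l)) * (R * (2 * s)) :=
          Nat.mul_le_mul h₁ (Nat.mul_le_mul_left _ (by omega))
      _ = 4 * E := by rw [hE]; ring
  have hNb : R ^ (s * l) ≤ 2 ^ (4 * E) := by
    rw [hR, ← pow_mul]
    refine up (le_trans ?_ (show E ≤ 4 * E by omega))
    rw [hE, mul_assoc]
    exact Nat.mul_le_mul_left _ (Nat.le_mul_of_pos_left _ hR0)
  have hl4 : 2 ^ l ≤ 2 ^ (4 * E) := up (by omega)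
  have hr4 : 2 ^ r ≤ 2 ^ (4 * E) := up (by omega)
  have h16 : 16 * 2 ^ (4 * E) ≤ 2 ^ (8 * E) := by
    calc 16 * 2 ^ (4 * E) = 2 ^ (4 + 4 * E) := by rw [pow_add]; norm_num
      _ ≤ 2 ^ (8 * E) := Nat.pow_le_pow_right two_pos (by omega)
  have hmn : m + n ≤ 2 * (n * m) := by nlinarith
  have hmn0 : 0 < n * m := by positivity
  have h1 : 1 ≤ 2 ^ (4 * E) := Nat.one_le_two_pow
  set X := 2 ^ (4 * E)
  calc _ ≤ 2 * (n * m) + 9 * X := by omega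
    _ ≤ 16 * X * (n * m) := by nlinarith
    _ ≤ 2 ^ (8 * E) * (n * m) := Nat.mul_le_mul_right _ h16

/-! ### The program -/

open RAM RAM.Term

/-- `[m, n, r, k, B] ↦ 2 ^ r`. In the course of the program, the environment grows to `m`, `n`,
`r`, `k`, the cut-off, `2 ^ r`, `bits k`, `radius k`, the number `2 ^ r * (radius k + 1)` of digits
of the first component of a guess, `farBound k`, and the numbers of values for the first and for
the second component of a guess. -/
def typesTerm : Term := call ![.const 2, .var 2] powT

/-- `[…, 2 ^ r] ↦ bits k` -/
def bitsTerm : Term :=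
  tcount 6 (.add (.var 3) (.const 1))
    (tle (call ![.const 2, .var 6] powT) (.add (.var 3) (.const 1)))

/-- `[…, bits k] ↦ radius k`, as the number of `i` with `(i + 1) ^ 2 * bits k < k`, plus `1` -/
def radiusTerm : Term :=
  .add (tcount 7 (.var 3) (.sub (.var 3) (call ![.add (.var 7) (.const 1),
    call ![.add (.var 7) (.const 1), .var 6] mulT] mulT))) (.const 1)

/-- `[…, radius k] ↦ 2 ^ r * (radius k + 1)` -/
def digitsTerm : Term := call ![.var 5, .add (.var 7) (.const 1)] mulT

/-- `[…, 2 ^ r * (radius k + 1)] ↦ farBound k` -/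
def farBoundTerm : Term := call ![.var 7, .var 6] mulT

/-- `[…, farBound k] ↦` the number of values for the first component of a guess -/
def firstTerm : Term := call ![.add (.add (.var 5) (.var 3)) (.const 1), .var 8] powT

/-- The number of values for the second component of a guess. -/
def secondTerm : Term := call ![.var 5, .var 9] powT

/-- Whether some guess passes the test. -/
def searchTerm : Term :=
  tex 12 (.var 10) (tex 14 (.var 11) (tle (call ![.var 0, .var 1, .var 2, .var 5, .var 7,
    .add (.add (.var 5) (.var 3)) (.const 1), .var 12, .var 14] Guess.totalT) (.var 3)))

/-- The program. Before the terms whose iterations grow longer, the cut-off in register `4` is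
raised. The last assignment turns the value of the condition `searchTerm` into `0` or `1`. -/
def program : Program :=
  .seq (.assign 4 (.plus (.plus (.plus (.plus (.reg 0) (.reg 1)) (.reg 2)) (.reg 3)) (.const 2))) <|
  .seq (typesTerm.compile (List.range 5) 5) <|
  .seq (bitsTerm.compile (List.range 6) 6) <|
  .seq (radiusTerm.compile (List.range 7) 7) <|
  .seq (.assign 4 (.plus (.reg 4) (.reg 5))) <|
  .seq (digitsTerm.compile (List.range 8) 8) <|
  .seq (farBoundTerm.compile (List.range 9) 9) <|
  .seq (.assign 4 (.plus (.plus (.reg 4) (.reg 8)) (.reg 9))) <|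
  .seq (firstTerm.compile (List.range 10) 10) <|
  .seq (secondTerm.compile (List.range 11) 11) <|
  .seq (.assign 4 (.plus (.plus (.reg 4) (.reg 10)) (.reg 11))) <|
  .seq (searchTerm.compile (List.range 12) 12) <|
  .assign 0 (.minus (.const 1) (.minus (.const 1) (.reg 12)))

variable {B m n r k : ℕ} {M : ℕ → ℕ}

theorem eval_typesTerm (h2 : 2 ≤ B) (hr : r ≤ B) :
    typesTerm.eval B M [m, n, r, k, B] = 2 ^ r :=
  (eval_call_two (x₁ := 2) (x₂ := r) rfl rfl).trans (eval_powT h2 hr)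

theorem eval_bitsTerm {R : ℕ} (h2 : 2 ≤ B) (hk : k + 1 ≤ B) :
    bitsTerm.eval B M [m, n, r, k, B, R] = bits k := by
  refine (eval_tcount (k := k + 1) (P := fun i => 2 ^ i ≤ k + 1) rfl rfl hk
    fun i hi y => ?_).trans (count_of_iff_lt (bits_le k) fun i _ => ?_)
  · rw [eval_tle, eval_call_two (x₁ := 2) (x₂ := i) rfl rfl, eval_powT h2 (by omega)]
    rfl
  · rw [bits, Nat.lt_succ_iff, Nat.le_log_iff_pow_le one_lt_two (Nat.succ_ne_zero k)]

theorem eval_radiusTerm {R : ℕ} (hk : k ≤ B) :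
    radiusTerm.eval B M [m, n, r, k, B, R, bits k] = radius k := by
  rw [radiusTerm, eval_add, radius]
  congr 1
  refine (eval_tcount (k := k) (P := fun i => (i + 1) * ((i + 1) * bits k) < k) rfl rfl hk
    fun i hi y => ?_).trans (count_of_iff_lt ?_ fun i hi => ?_)
  · rw [eval_sub, eval_call_two (x₁ := i + 1) rfl
      ((eval_call_two (x₁ := i + 1) (x₂ := bits k) rfl rfl).trans (eval_mulT (by omega))),
      eval_mulT (by omega)]
    exact Nat.sub_ne_zero_iff_lt
  · exact (Nat.sqrt_le_self _).trans ((Nat.div_le_self _ _).trans (Nat.sub_le _ _))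
  · rw [Nat.lt_iff_add_one_le (m := i), Nat.le_sqrt, Nat.le_div_iff_mul_le (bits_pos k), mul_assoc]
    omega

theorem eval_searchTerm (x : Instance) {l s D K N N' : ℕ}
    (h : ∀ Y < N, ∀ Z < N', (Guess.mk x.matrix x.m x.n x.r s (2 ^ x.r + x.k + 1) Y Z).Fits B
      x.input.mem) (hN : N ≤ B) (hN' : N' ≤ B) :
    searchTerm.eval B x.input.mem [x.m, x.n, x.r, x.k, B, 2 ^ x.r, l, s, D, K, N, N'] ≠ 0 ↔
      ∃ Y < N, ∃ Z < N',
        (Guess.mk x.matrix x.m x.n x.r s (2 ^ x.r + x.k + 1) Y Z).total ≤ x.k := by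
  refine eval_tex (k := N) rfl rfl hN fun Y hY y => ?_
  refine eval_tex (k := N') rfl rfl hN' fun Z hZ z => ?_
  rw [eval_tle, ← (h Y hY Z hZ).eval_totalT]
  rfl

/-- The program decides the problem, within a time polynomial in the final cut-off. -/
theorem program_correct : ∃ C d : ℕ, ∀ x : Instance, ∃ (s : State) (t : ℕ),
    Exec program x.input s t ∧ t ≤ C * (cutoff x.m x.n x.r x.k + 1) ^ d ∧
      (x.IsYes → s.reg 0 = 1) ∧ (¬ x.IsYes → s.reg 0 = 0) := by
  obtain ⟨C₁, d₁, h₁⟩ := typesTerm.cost_le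
  obtain ⟨C₂, d₂, h₂⟩ := bitsTerm.cost_le
  obtain ⟨C₃, d₃, h₃⟩ := radiusTerm.cost_le
  obtain ⟨C₄, d₄, h₄⟩ := digitsTerm.cost_le
  obtain ⟨C₅, d₅, h₅⟩ := farBoundTerm.cost_le
  obtain ⟨C₆, d₆, h₆⟩ := firstTerm.cost_le
  obtain ⟨C₇, d₇, h₇⟩ := secondTerm.cost_le
  obtain ⟨C₈, d₈, h₈⟩ := searchTerm.cost_le
  refine ⟨C₁ + C₂ + C₃ + C₄ + C₅ + C₆ + C₇ + C₈ + 40,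
    d₁ + d₂ + d₃ + d₄ + d₅ + d₆ + d₇ + d₈, fun x => ?_⟩
  set R := 2 ^ x.r with hR
  set l := bits x.k with hl
  set q := radius x.k with hq
  set D := R * (q + 1) with hD
  set K := farBound x.k with hK
  set N := (R + x.k + 1) ^ D with hN
  set N' := R ^ K with hN'
  obtain ⟨B₁, hB₁⟩ : ∃ B₁, B₁ = x.m + x.n + x.r + x.k + 2 := ⟨_, rfl⟩
  obtain ⟨B₂, hB₂⟩ : ∃ B₂, B₂ = B₁ + R := ⟨_, rfl⟩
  obtain ⟨B₃, hB₃⟩ : ∃ B₃, B₃ = B₂ + D + K := ⟨_, rfl⟩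
  obtain ⟨B₄, hB₄⟩ : ∃ B₄, B₄ = B₃ + N + N' := ⟨_, rfl⟩
  have hcut : cutoff x.m x.n x.r x.k = B₄ := by rw [hB₄, hB₃, hB₂, hB₁]; rfl
  have hB₁₂ : B₁ ≤ B₂ := hB₂ ▸ Nat.le_add_right B₁ R
  have hB₂₃ : B₂ ≤ B₃ := by rw [hB₃, add_assoc]; exact Nat.le_add_right _ _
  have hB₃₄ : B₃ ≤ B₄ := by rw [hB₄, add_assoc]; exact Nat.le_add_right _ _
  have hl_le : l ≤ x.k + 1 := bits_le x.k
  have hq_le : q ≤ x.k + 1 := radius_le x.k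
  have hfits : ∀ Y < N, ∀ Z < N', (Guess.mk x.matrix x.m x.n x.r q (R + x.k + 1) Y Z).Fits B₄
      x.input.mem := fun Y hY Z hZ =>
    { mem := fun _ _ => rfl
      two := by omega
      m := by change x.m ≤ _; omega
      n := by change x.n ≤ _; omega
      r := by change x.r ≤ _; omega
      types := by change R ≤ _; omega
      s := by change q ≤ _; omega
      b_pos := Nat.succ_pos _
      b := by change R + x.k + 1 ≤ _; omega
      Y := by change Y ≤ _; omega
      Z := by change Z ≤ _; omega
      digits := by change D ≤ _; omega }
  have s₀ : Holds x.input.mem [x.m, x.n, x.r, x.k, 0] x.input := by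
    refine ⟨rfl, fun i hi => ?_⟩
    change i < 5 at hi
    interval_cases i <;> rfl
  have r₁ := runs_assign (M := x.input.mem) (e := [x.m, x.n, x.r, x.k, 0]) (i := 4) (v := B₁)
    (x := .plus (.plus (.plus (.plus (.reg 0) (.reg 1)) (.reg 2)) (.reg 3)) (.const 2))
    fun s hs => by
      simp only [Expr.eval, hs.2 0 (by simp), hs.2 1 (by simp), hs.2 2 (by simp),
        hs.2 3 (by simp)]
      exact hB₁.symm
  have r₂ := runs_compile (M := x.input.mem) (B := B₁) (e := [x.m, x.n, x.r, x.k, B₁])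
    (by simp) rfl (eval_typesTerm (by omega) (by omega))
  have r₃ := runs_compile (M := x.input.mem) (B := B₁) (e := [x.m, x.n, x.r, x.k, B₁, R])
    (by simp) rfl (eval_bitsTerm (by omega) (by omega))
  have r₄ := runs_compile (M := x.input.mem) (B := B₁) (e := [x.m, x.n, x.r, x.k, B₁, R, l])
    (by simp) rfl (eval_radiusTerm (by omega))
  have r₅ := runs_assign (M := x.input.mem) (e := [x.m, x.n, x.r, x.k, B₁, R, l, q]) (i := 4)
    (v := B₂) (x := .plus (.reg 4) (.reg 5))
    fun s hs => by
      simp only [Expr.eval, hs.2 4 (by simp), hs.2 5 (by simp)]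
      exact hB₂.symm
  have r₆ := runs_compile (M := x.input.mem) (B := B₂) (e := [x.m, x.n, x.r, x.k, B₂, R, l, q])
    (t := digitsTerm) (v := D) (by simp) rfl
    ((eval_call_two (x₁ := R) (x₂ := q + 1) rfl rfl).trans (eval_mulT (by omega)))
  have r₇ := runs_compile (M := x.input.mem) (B := B₂) (e := [x.m, x.n, x.r, x.k, B₂, R, l, q, D])
    (t := farBoundTerm) (v := K) (by simp) rfl
    ((eval_call_two (x₁ := q) (x₂ := l) rfl rfl).trans (eval_mulT (by omega)))
  have r₈ := runs_assign (M := x.input.mem) (e := [x.m, x.n, x.r, x.k, B₂, R, l, q, D, K])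
    (i := 4) (v := B₃) (x := .plus (.plus (.reg 4) (.reg 8)) (.reg 9))
    fun s hs => by
      simp only [Expr.eval, hs.2 4 (by simp), hs.2 8 (by simp), hs.2 9 (by simp)]
      exact hB₃.symm
  have r₉ := runs_compile (M := x.input.mem) (B := B₃) (e := [x.m, x.n, x.r, x.k, B₃, R, l, q, D, K])
    (t := firstTerm) (v := N) (by simp) rfl
    ((eval_call_two (x₁ := R + x.k + 1) (x₂ := D) rfl rfl).trans
      (eval_powT (by omega) (by omega)))
  have r₁₀ := runs_compile (M := x.input.mem) (B := B₃) (e := [x.m, x.n, x.r, x.k, B₃, R, l, q, D, K, N])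
    (t := secondTerm) (v := N') (by simp) rfl
    ((eval_call_two (x₁ := R) (x₂ := K) rfl rfl).trans
      (eval_powT (by omega) (by omega)))
  have r₁₁ := runs_assign (M := x.input.mem)
    (e := [x.m, x.n, x.r, x.k, B₃, R, l, q, D, K, N, N']) (i := 4) (v := B₄)
    (x := .plus (.plus (.reg 4) (.reg 10)) (.reg 11))
    fun s hs => by
      simp only [Expr.eval, hs.2 4 (by simp), hs.2 10 (by simp), hs.2 11 (by simp)]
      exact hB₄.symm
  set e := [x.m, x.n, x.r, x.k, B₄, R, l, q, D, K, N, N'] with he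
  have r₁₂ := runs_compile (M := x.input.mem) (B := B₄) (e := e) (t := searchTerm) (by simp [he]) rfl rfl
  set w := searchTerm.eval B₄ x.input.mem e with hw
  have r₁₃ := runs_assign (M := x.input.mem) (e := e ++ [w]) (i := 0) (v := 1 - (1 - w))
    (x := .minus (.const 1) (.minus (.const 1) (.reg 12)))
    fun s hs => by
      simp only [Expr.eval, hs.2 12 (by simp [he])]
      rfl
  obtain ⟨s, t, hx, hs, ht⟩ := r₁.seq (r₂.seq (r₃.seq (r₄.seq (r₅.seq (r₆.seq (r₇.seq
    (r₈.seq (r₉.seq (r₁₀.seq (r₁₁.seq (r₁₂.seq r₁₃))))))))))) _ s₀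
  have hres : s.reg 0 = 1 - (1 - w) := hs.2 0 (by simp [he])
  have hyes : x.IsYes ↔ w ≠ 0 := by
    rw [x.isYes_iff (le_radius_mul_farBound x.k)]
    exact (eval_searchTerm x hfits (by omega) (by omega)).symm
  refine ⟨s, t, hx, ?_, fun h => ?_, fun h => ?_⟩
  · have up : ∀ {C d c B : ℕ}, c ≤ C * (B + 1) ^ d → B ≤ B₄ →
        d ≤ d₁ + d₂ + d₃ + d₄ + d₅ + d₆ + d₇ + d₈ →
        c ≤ C * (B₄ + 1) ^ (d₁ + d₂ + d₃ + d₄ + d₅ + d₆ + d₇ + d₈) := fun h hB hd =>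
      h.trans (Nat.mul_le_mul_left _ ((Nat.pow_le_pow_left (Nat.succ_le_succ hB) _).trans
        (Nat.pow_le_pow_right (Nat.succ_pos _) hd)))
    have g₁ := up (h₁ B₁) (by omega) (by omega)
    have g₂ := up (h₂ B₁) (by omega) (by omega)
    have g₃ := up (h₃ B₁) (by omega) (by omega)
    have g₄ := up (h₄ B₂) (by omega) (by omega)
    have g₅ := up (h₅ B₂) (by omega) (by omega)
    have g₆ := up (h₆ B₃) (by omega) (by omega)
    have g₇ := up (h₇ B₃) (by omega) (by omega)
    have g₈ := up (h₈ B₄) (by omega) (by omega)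
    rw [hcut]
    have hX : 1 ≤ (B₄ + 1) ^ (d₁ + d₂ + d₃ + d₄ + d₅ + d₆ + d₇ + d₈) :=
      Nat.one_le_pow _ _ (Nat.succ_pos _)
    set X := (B₄ + 1) ^ (d₁ + d₂ + d₃ + d₄ + d₅ + d₆ + d₇ + d₈)
    simp only [Expr.cost] at ht
    refine ht.trans ?_
    simp only [add_mul]
    omega
  · have := hyes.1 h
    omega
  · have := mt hyes.2 h
    omega

end BoolRank

theorem theorem9 :
    ∃ (p : RAM.Program) (c d : ℕ),
      RAM.DecidesInTime p BoolRank.Instance.input BoolRank.Instance.IsYes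
        (fun x => (2 : ℝ) ^ ((c : ℝ) * ((x.r : ℝ) * 2 ^ x.r *
            max 1 (Real.sqrt ((x.k : ℝ) * Real.logb 2 (x.k : ℝ))))) *
          ((x.n : ℝ) * (x.m : ℝ)) ^ d) := by
  obtain ⟨C, d, h⟩ := BoolRank.program_correct
  refine ⟨BoolRank.program, 4 * (C + 8 * d), d, fun x => ?_⟩
  obtain ⟨s, t, hx, ht, hyes, hno⟩ := h x
  refine ⟨s, t, hx, ?_, hyes, hno⟩
  set μ := max 1 (Real.sqrt ((x.k : ℝ) * Real.logb 2 (x.k : ℝ)))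
  set E := x.r * 2 ^ x.r * BoolRank.farBound x.k with hE
  have hE0 : 0 < E := Nat.mul_pos (Nat.mul_pos x.r_pos (Nat.two_pow_pos _))
    (Nat.mul_pos (Nat.succ_pos _) (BoolRank.bits_pos _))
  have h₁ : t ≤ 2 ^ ((C + 8 * d) * E) * (x.n * x.m) ^ d := by
    calc t ≤ C * (BoolRank.cutoff x.m x.n x.r x.k + 1) ^ d := ht
      _ ≤ 2 ^ (C * E) * (2 ^ (8 * E) * (x.n * x.m)) ^ d := by
        refine Nat.mul_le_mul ?_ (Nat.pow_le_pow_left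
          (BoolRank.cutoff_le x.m_pos x.n_pos x.r_pos) d)
        exact Nat.lt_two_pow_self.le.trans
          (Nat.pow_le_pow_right two_pos (Nat.le_mul_of_pos_right C hE0))
      _ = _ := by rw [mul_pow, ← pow_mul, ← mul_assoc, ← pow_add]; congr 2; ring
  have h₂ : (E : ℝ) ≤ x.r * 2 ^ x.r * (4 * μ) := by
    rw [hE]
    push_cast
    exact mul_le_mul_of_nonneg_left (BoolRank.farBound_le x.k) (by positivity)
  calc (t : ℝ) ≤ ((2 ^ ((C + 8 * d) * E) * (x.n * x.m) ^ d : ℕ) : ℝ) := by exact_mod_cast h₁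
    _ = (2 : ℝ) ^ (((C + 8 * d) * E : ℕ) : ℝ) * ((x.n : ℝ) * x.m) ^ d := by
      rw [Real.rpow_natCast]; push_cast; rfl
    _ ≤ _ := by
      refine mul_le_mul_of_nonneg_right (Real.rpow_le_rpow_of_exponent_le one_le_two ?_)
        (by positivity)
      have := mul_le_mul_of_nonneg_left h₂ (show (0 : ℝ) ≤ C + 8 * d by positivity)
      push_cast
      linarith
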